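/- Let $U\subset\mathbb R^n$ be a domain (connectedness is not needed: any open set), let $\psi:U\to\mathbb R^k$ be smooth, and let $\Sigma=\{(x,\psi(x)):x\in U\}\subset\mathbb R^{n+k}$ be its graph. Let $A(X,Y)=(D_XY)^\perp$ be the second fundamental form of $\Sigma$, $H=\operatorname{trace}A$ the mean curvature vector, and $\nabla^\perp_X\eta=(D_X\eta)^\perp$ the connection on the normal bundle $N\Sigma$. Assume that the normal bundle is flat, i.e. $R^\perp(X,Y)\zeta=\nabla^\perp_X\nabla^\perp_Y\zeta-\nabla^\perp_Y\nabla^\perp_X\zeta-\nabla^\perp_{[X,Y]}\zeta=0$ for all smooth tangent vector fields $X,Y$ and all smooth normal sections $\zeta$. Let $(e_i)_{1\le i\le n}$ and $(e_\alpha)_{n+1\le\alpha\le n+k}$ be orthonormal bases of $T_p\Sigma$ and $N_p\Sigma$ at each point $p\in\Sigma$, and write $H_\alpha=\langle H,e_\alpha\rangle$, $\nabla_iH_\alpha=\langle\nabla^\perp_{e_i}H,e_\alpha\rangle$, $|A|^2=\sum_{i,j}|A(e_i,e_j)|^2$, $|\nabla\varphi|^2=\sum_i(d\varphi(e_i))^2$.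 Let $\Omega=dx^1\wedge\dots\wedge dx^n$ on $\mathbb R^{n+k}$, let $w=\Omega(e_1,\dots,e_n)$, let $\Omega_{\alpha i}=\Omega(e_1,\dots,e_\alpha,\dots,e_n)$ with $e_\alpha$ in the $i$-th position, and put $$K_1=\Big(w^{-1}\sum_{\alpha,i}\Omega_{\alpha i}\,\nabla_iH_\alpha\Big)^+,$$ where $g^+=\max(g,0)$. Then, for every $\varphi\in C_c^\infty(\Sigma)$, the functions $|A|^2\varphi^2$ and $|\nabla\varphi|^2+K_1\varphi^2$ are integrable on $\Sigma$ with respect to the $n$-dimensional Hausdorff measure $\mathcal H^n$, and $$\int_\Sigma|A|^2\varphi^2\,d\mathcal H^n\le\int_\Sigma\big(|\nabla\varphi|^2+K_1\varphi^2\big)\,d\mathcal H^n .$$ -/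

import Mathlib

open MeasureTheory Set
open scoped ContDiff

noncomputable section

namespace FlatGraph

variable {n m k : ℕ}

/-- Euclidean space of dimension `d`. -/
abbrev E (d : ℕ) : Type := EuclideanSpace ℝ (Fin d)

/-! ### Geometry of an immersion `f`, in a coordinate domain

The manifold is an open subset of `E n`, immersed in `E m` by `f`. Tangent vectors at `x` are
vectors `u : E n`, identified with `df_x(u)`, which lies in `tangentSpace f x`. -/

/-- The induced metric `g(u, v) = ⟨df(u), df(v)⟩` at `x`. -/
def inducedMetric (f : E n → E m) (x u v : E n) : ℝ :=
  inner ℝ (fderiv ℝ f x u) (fderiv ℝ f x v)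

/-- The tangent space at `x`, as a subspace of the ambient space. -/
def tangentSpace (f : E n → E m) (x : E n) : Submodule ℝ (E m) :=
  LinearMap.range (fderiv ℝ f x).toLinearMap

/-- The normal space at `x`. -/
def normalSpace (f : E n → E m) (x : E n) : Submodule ℝ (E m) :=
  (tangentSpace f x)ᗮ

/-- The orthogonal projection `(·)^⊥` onto the normal space at `x`. -/
def normalProj (f : E n → E m) (x : E n) : E m →L[ℝ] E m :=
  (normalSpace f x).starProjection

/-- The second fundamental form `A(X, Y) = (D_X Y)^⊥` at `x`. Being tensorial, it is computed by
extending the tangent vector `v` to the coordinate-constant vector field `y ↦ df_y(v)`. -/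
def secondFundamentalForm (f : E n → E m) (x u v : E n) : E m :=
  normalProj f x (fderiv ℝ (fun y => fderiv ℝ f y v) x u)

/-- The normal connection `∇^⊥_u η = (D_u η)^⊥` at `x`. -/
def normalDeriv (f : E n → E m) (η : E n → E m) (x u : E n) : E m :=
  normalProj f x (fderiv ℝ η x u)

/-- The curvature of the normal connection,
`R^⊥(X,Y)ζ = ∇^⊥_X ∇^⊥_Y ζ - ∇^⊥_Y ∇^⊥_X ζ - ∇^⊥_{[X,Y]} ζ`, at `x`. -/
def normalCurvature (f : E n → E m) (X Y : E n → E n) (ζ : E n → E m) (x : E n) : E m :=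
  normalDeriv f (fun y => normalDeriv f ζ y (Y y)) x (X x)
    - normalDeriv f (fun y => normalDeriv f ζ y (X y)) x (Y x)
    - normalDeriv f ζ x (VectorField.lieBracket ℝ X Y x)

/-- The normal bundle of `f` over `U` is flat: `R^⊥(X,Y)ζ = 0` on `U` for all smooth tangent
vector fields `X`, `Y` and all smooth normal sections `ζ`. -/
def FlatNormalBundle (f : E n → E m) (U : Set (E n)) : Prop :=
  ∀ (X Y : E n → E n) (ζ : E n → E m),
    ContDiffOn ℝ ∞ X U → ContDiffOn ℝ ∞ Y U → ContDiffOn ℝ ∞ ζ U →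
    (∀ x ∈ U, ζ x ∈ normalSpace f x) →
    ∀ x ∈ U, normalCurvature f X Y ζ x = 0

/-- `e x` is, for every `x ∈ U`, an orthonormal basis of the tangent space at `x`. -/
def IsTangentFrame (f : E n → E m) (U : Set (E n)) (e : E n → Fin n → E n) : Prop :=
  ∀ x ∈ U, ∀ i j, inducedMetric f x (e x i) (e x j) = if i = j then 1 else 0

/-- `ν x` is, for every `x ∈ U`, an orthonormal basis of the normal space at `x`
(of dimension `k` when `f : E n → E (n + k)` is an immersion). -/
def IsNormalFrame (f : E n → E (n + k)) (U : Set (E n)) (ν : E n → Fin k → E (n + k)) : Prop :=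
  ∀ x ∈ U, (∀ a, ν x a ∈ normalSpace f x) ∧ Orthonormal ℝ (ν x)

/-- The mean curvature vector `H = trace A = ∑ᵢ A(eᵢ, eᵢ)`. -/
def meanCurvature (f : E n → E m) (e : E n → Fin n → E n) (x : E n) : E m :=
  ∑ i, secondFundamentalForm f x (e x i) (e x i)

/-- `|A|² = ∑ᵢⱼ |A(eᵢ, eⱼ)|²`. -/
def normSqA (f : E n → E m) (e : E n → Fin n → E n) (x : E n) : ℝ :=
  ∑ i, ∑ j, ‖secondFundamentalForm f x (e x i) (e x j)‖ ^ 2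

/-- `|∇φ|² = ∑ᵢ (dφ(eᵢ))²` for a function `φ` on the image of `f`. -/
def normSqGrad (f : E n → E m) (e : E n → Fin n → E n) (φ : E m → ℝ) (x : E n) : ℝ :=
  ∑ i, (fderiv ℝ (fun y => φ (f y)) x (e x i)) ^ 2

/-- The parallel `n`-form `Ω = dx¹ ∧ ⋯ ∧ dxⁿ` on `E (n + k)`. -/
def parallelForm (v : Fin n → E (n + k)) : ℝ :=
  Matrix.det (Matrix.of fun i j => v j (Fin.castAdd k i))

/-- `w = Ω(e₁, …, eₙ)`, which is `*Ω` for the orientation given by the frame. -/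
def w (f : E n → E (n + k)) (e : E n → Fin n → E n) (x : E n) : ℝ :=
  parallelForm fun i => fderiv ℝ f x (e x i)

/-- `Ω_{αi} = Ω(e₁, …, e_α, …, eₙ)` with `e_α = ν x a` in the `i`-th position. -/
def formCoeff (f : E n → E (n + k)) (e : E n → Fin n → E n) (ν : E n → Fin k → E (n + k))
    (x : E n) (a : Fin k) (i : Fin n) : ℝ :=
  parallelForm (Function.update (fun j => fderiv ℝ f x (e x j)) i (ν x a))

/-- `∇ᵢ H_α = ⟨∇^⊥_{eᵢ} H, e_α⟩`. -/
def gradH (f : E n → E (n + k)) (e : E n → Fin n → E n) (ν : E n → Fin k → E (n + k))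
    (x : E n) (a : Fin k) (i : Fin n) : ℝ :=
  inner ℝ (normalDeriv f (meanCurvature f e) x (e x i)) (ν x a)

/-- `K₁ = (w⁻¹ ∑_{α,i} Ω_{αi} ∇ᵢ H_α)⁺`. Reversing the orientation of the tangent frame changes the
sign of both `w` and `Ω_{αi}`, so that `K₁` does not depend on it. -/
def K₁ (f : E n → E (n + k)) (e : E n → Fin n → E n) (ν : E n → Fin k → E (n + k))
    (x : E n) : ℝ :=
  max ((w f e x)⁻¹ * ∑ a, ∑ i, formCoeff f e ν x a i * gradH f e ν x a i) 0

/-! ### Graphs -/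

/-- The embedding `x ↦ (x, ψ x)`. -/
def graphMap (ψ : E n → E k) (x : E n) : E (n + k) :=
  WithLp.toLp 2 (Fin.append (fun i => x i) (fun a => ψ x a))

/-- The graph `{(x, ψ x) : x ∈ U}`. -/
def graph (U : Set (E n)) (ψ : E n → E k) : Set (E (n + k)) :=
  graphMap ψ '' U

/-- The projection `(x, y) ↦ x`; on the graph it is the inverse of `graphMap ψ`. -/
def base (p : E (n + k)) : E n :=
  WithLp.toLp 2 fun i => p (Fin.castAdd k i)

/-- `φ` is a test function of class `C_c^∞` on the graph: it is smooth in the graph coordinates and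
vanishes on the graph outside a compact subset of the graph. The values of `φ` away from the graph
are irrelevant. -/
structure IsTestFunction (U : Set (E n)) (ψ : E n → E k) (φ : E (n + k) → ℝ) : Prop where
  smooth : ContDiffOn ℝ ∞ (fun x => φ (graphMap ψ x)) U
  compact_support : ∃ C ⊆ graph U ψ, IsCompact C ∧ ∀ p ∈ graph U ψ, p ∉ C → φ p = 0

end FlatGraph

end

open Filter Topology
open scoped ENNReal NNReal

namespace FlatGraph

/-! ### The area formula for Hausdorff measure. -/

section AreaFormula

/-! Let `f` be the graph map, `g` the induced metric and `J = √det g`, so that `w = ±1/J`. Let `tr`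
denote the term `w⁻¹ ∑ Ω_{αi} ∇ᵢH_α`. The theorem rests on the identity `Δ log |w| = tr - |A|² - |∇
log |w||²`, valid when the normal bundle is flat. Multiplied by `φ²` and integrated by parts, it
becomes `∫ |A|²φ² = ∫ (|∇φ|² + tr φ² - |∇φ - φ ∇ log |w||²)`. Dropping the square and replacing `tr`
by its positive part gives the inequality.

The identity is proved in coordinates. The horizontal components of `f` are linear, so `∂ᵢ∂ⱼf` is
vertical and the horizontal components of `Aᵢⱼ` are `-Γᶜᵢⱼ`. The traced Gauss equation then
expresses the coordinate divergence of `∇ log |w|` as `tr - |A|²` up to quadratic terms in `Γ`.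
These cancel by the Ricci equation `IsImmersionOn.sum_sff_mul_sff_comm` tested on horizontal
vectors; see `divergence_identity` and `IsGraphOn.sum_pd_gradLog_eq`.

The frames `e` and `ν` carry no regularity. Every frame expression is therefore first rewritten as a
coordinate contraction; for `tr` this is Cramer's rule, in `IsGraphOn.inv_w_mul_sum_eq`. Completing
the square is done pointwise in `IsGraphOn.jac_mul_sqA_le`, and
`map_restrict_image_hausdorffMeasure` carries integrals from the graph to `U`. -/

theorem hausdorffMeasure_image_le_of_edist_le {X Y Z : Type*} [EMetricSpace Y] [EMetricSpace Z]
    [MeasurableSpace Y] [BorelSpace Y] [MeasurableSpace Z] [BorelSpace Z]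
    {g : X → Y} {h : X → Z} {s : Set X} {K : ℝ≥0} {d : ℝ} (hd : 0 ≤ d)
    (hgh : ∀ y ∈ s, ∀ z ∈ s, edist (g y) (g z) ≤ K * edist (h y) (h z)) :
    Measure.hausdorffMeasure d (g '' s) ≤ (K : ℝ≥0∞) ^ d * Measure.hausdorffMeasure d (h '' s) := by
  rcases s.eq_empty_or_nonempty with rfl | ⟨x₀, -⟩
  · simp
  have : Nonempty X := ⟨x₀⟩
  -- The map `g ∘ r` is `K`-Lipschitz from `h '' s` onto `g '' s`. The bound forces `g` to agree
  -- wherever `h` does, so the choice of preimages does not matter.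
  set r : Z → X := Function.invFunOn h s
  have hr : ∀ p ∈ h '' s, r p ∈ s ∧ h (r p) = p := fun p hp =>
    ⟨Function.invFunOn_mem hp, Function.invFunOn_eq hp⟩
  have hLip : LipschitzOnWith K (g ∘ r) (h '' s) := by
    intro p hp q hq
    simpa [(hr p hp).2, (hr q hq).2] using hgh _ (hr p hp).1 _ (hr q hq).1
  refine le_trans (measure_mono ?_) (hLip.hausdorffMeasure_image_le hd)
  rintro _ ⟨y, hy, rfl⟩
  have hy' := mem_image_of_mem h hy
  refine ⟨h y, hy', ?_⟩
  have := hgh _ (hr _ hy').1 _ hy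
  rw [(hr _ hy').2, edist_self, mul_zero, nonpos_iff_eq_zero, edist_eq_zero] at this
  exact this

/-- By Lindelöf, countably many of the neighbourhoods cover `U`; made disjoint, they turn the local
comparison into a global one by countable additivity. -/
theorem measure_le_of_locally_le {X : Type*} [TopologicalSpace X] [SecondCountableTopology X]
    [MeasurableSpace X] [OpensMeasurableSpace X] {μ ν : Measure X} {U : Set X}
    (hμ : μ Uᶜ = 0)
    (h : ∀ x ∈ U, ∃ W ∈ 𝓝 x, ∀ s ⊆ W, MeasurableSet s → μ s ≤ ν s) : μ ≤ ν := by
  choose! W hW hle using h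
  have hW' : ∀ x ∈ U, interior (W x) ∈ 𝓝[U] x := fun x hx =>
    mem_nhdsWithin_of_mem_nhds (interior_mem_nhds.2 (hW x hx))
  obtain ⟨t, htU, htc, hcov⟩ := TopologicalSpace.countable_cover_nhdsWithin hW'
  rcases t.eq_empty_or_nonempty with rfl | hne
  · have hμ0 : μ = 0 := by
      rw [← Measure.measure_univ_eq_zero]
      have hU : U = ∅ := by simpa using hcov
      simpa [hU] using hμ
    rw [hμ0]
    exact Measure.zero_le ν
  obtain ⟨f, hf⟩ := htc.exists_eq_range hne
  refine Measure.le_iff.2 fun s hs => ?_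
  let A : ℕ → Set X := disjointed fun i => interior (W (f i))
  have hAm : ∀ i, MeasurableSet (A i) :=
    fun i => MeasurableSet.disjointed (fun j => isOpen_interior.measurableSet) i
  have hAsub : ∀ i, A i ⊆ W (f i) := fun i => (disjointed_subset _ i).trans interior_subset
  have hAU : U ⊆ ⋃ i, A i := by
    rw [iUnion_disjointed]
    intro x hx
    obtain ⟨y, hy, hxy⟩ := mem_iUnion₂.1 (hcov hx)
    rw [hf] at hy
    obtain ⟨i, rfl⟩ := hy
    exact mem_iUnion.2 ⟨i, hxy⟩
  have hdisj : Pairwise fun i j => Disjoint (s ∩ A i) (s ∩ A j) := fun i j hij =>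
    (disjoint_disjointed _ hij).mono inter_subset_right inter_subset_right
  calc μ s ≤ μ ((⋃ i, s ∩ A i) ∪ Uᶜ) := by
        refine measure_mono fun x hx => ?_
        by_cases hxU : x ∈ U
        · left
          rw [← inter_iUnion]
          exact ⟨hx, hAU hxU⟩
        · exact Or.inr hxU
    _ ≤ μ (⋃ i, s ∩ A i) + μ Uᶜ := measure_union_le _ _
    _ = ∑' i, μ (s ∩ A i) := by
        rw [hμ, add_zero, measure_iUnion hdisj fun i => hs.inter (hAm i)]
    _ ≤ ∑' i, ν (s ∩ A i) := ENNReal.tsum_le_tsum fun i =>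
        hle _ (htU (hf ▸ mem_range_self i)) _ (inter_subset_right.trans (hAsub i))
          (hs.inter (hAm i))
    _ = ν (⋃ i, s ∩ A i) := (measure_iUnion hdisj fun i => hs.inter (hAm i)).symm
    _ ≤ ν s := measure_mono (iUnion_subset fun i => inter_subset_left)

/-- The distortion `K ^ d` of the local comparisons disappears as `K` decreases to `1`. -/
theorem measure_le_of_forall_one_lt {X : Type*} [MeasurableSpace X] {μ ν : Measure X} (d : ℕ)
    (h : ∀ K : ℝ≥0, 1 < K → μ ≤ ((K : ℝ≥0∞) ^ d) • ν) : μ ≤ ν := by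
  refine Measure.le_iff.2 fun s _ => ?_
  have hK : Tendsto (fun K : ℝ≥0 => ((K : ℝ≥0∞) ^ d) * ν s) (𝓝[>] 1)
      (𝓝 (((1 : ℝ≥0) : ℝ≥0∞) ^ d * ν s)) := by
    refine ENNReal.Tendsto.mul_const ?_ (Or.inl (by simp))
    exact (((ENNReal.continuous_pow d).comp ENNReal.continuous_coe).tendsto 1).mono_left
      nhdsWithin_le_nhds
  have := ge_of_tendsto hK (b := μ s) (by
    filter_upwards [self_mem_nhdsWithin] with K hK
    simpa using (h K hK) s)
  simpa using this

variable {n m : ℕ}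

/-- Using Hausdorff measure on the base as well as on the graph keeps the area formula free of a
normalising constant, while still allowing integration by parts. -/
instance isAddHaarMeasure_hausdorffMeasure_E :
    (Measure.hausdorffMeasure (n : ℝ) : Measure (E n)).IsAddHaarMeasure := by
  have h : Module.finrank ℝ (E n) = n := by simp
  have := isAddHaarMeasure_hausdorffMeasure (E := E n)
  rwa [h] at this

/-- The Jacobian of `f` with respect to the `n`-dimensional measure. -/
noncomputable def jac (f : E n → E m) (x : E n) : ℝ :=
  (fderiv ℝ f x).toLinearMap.normDet

/-- Near `x`, distances between values of `f` and of its differential agree up to the factor `K`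
both ways, and a linear map scales the measure exactly by its Jacobian. The expansion bound `hL`
lets the error `ε‖y - z‖` be absorbed into `‖L y - L z‖`. -/
theorem exists_nhds_hausdorffMeasure_image_le {f : E n → E m} {x : E n}
    (hf : HasStrictFDerivAt f (fderiv ℝ f x) x) (hL : ∀ v, ‖v‖ ≤ ‖fderiv ℝ f x v‖)
    {K : ℝ≥0} (hK : 1 < K) : ∃ W ∈ 𝓝 x, ∀ s ⊆ W,
      Measure.hausdorffMeasure (n : ℝ) (f '' s) ≤
        (K : ℝ≥0∞) ^ n * (ENNReal.ofReal (jac f x) * Measure.hausdorffMeasure (n : ℝ) s) ∧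
      ENNReal.ofReal (jac f x) * Measure.hausdorffMeasure (n : ℝ) s ≤
        (K : ℝ≥0∞) ^ n * Measure.hausdorffMeasure (n : ℝ) (f '' s) := by
  have hK' : (1 : ℝ) < K := by exact_mod_cast hK
  have hK0 : (0 : ℝ) < K := one_pos.trans hK'
  -- This choice gives both `1 + ε ≤ K` and `1 - ε = K⁻¹`, so one error bound serves both
  -- directions.
  set ε : ℝ := 1 - (K : ℝ)⁻¹ with hε
  have hinv : (K : ℝ)⁻¹ < 1 := inv_lt_one_of_one_lt₀ hK'
  have hε0 : 0 < ε := by linarith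
  have hnhds : ∀ᶠ p in 𝓝 x ×ˢ 𝓝 x,
      ‖f p.1 - f p.2 - fderiv ℝ f x (p.1 - p.2)‖ ≤ ε * ‖p.1 - p.2‖ := by
    rw [← nhds_prod_eq]
    exact (hf.isLittleO).def hε0
  obtain ⟨W, hW, hWW⟩ := Filter.mem_prod_same_iff.1 hnhds
  have hWW' : ∀ y ∈ W, ∀ z ∈ W, ‖f y - f z - fderiv ℝ f x (y - z)‖ ≤ ε * ‖y - z‖ :=
    fun y hy z hz => by
    have h := hWW (mk_mem_prod hy hz)
    exact h
  set L := fderiv ℝ f x with hLdef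
  have key : ∀ y ∈ W, ∀ z ∈ W, ‖f y - f z - L (y - z)‖ ≤ ε * ‖L y - L z‖ := by
    intro y hy z hz
    have h1 : ‖f y - f z - L (y - z)‖ ≤ ε * ‖y - z‖ := hWW' y hy z hz
    rw [← map_sub]
    exact h1.trans (mul_le_mul_of_nonneg_left (hL _) hε0.le)
  have hmul : (K : ℝ) * (K : ℝ)⁻¹ = 1 := mul_inv_cancel₀ hK0.ne'
  have lin : ∀ s, Measure.hausdorffMeasure (n : ℝ) (L '' s) =
      ENNReal.ofReal (jac f x) * Measure.hausdorffMeasure (n : ℝ) s := by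
    intro s
    have := L.toLinearMap.hausdorffMeasure_image s
    simpa [jac] using this
  have up : ∀ y ∈ W, ∀ z ∈ W, edist (f y) (f z) ≤ K * edist (L y) (L z) := by
    intro y hy z hz
    have h1 := key y hy z hz
    have h2 : ‖f y - f z‖ ≤ K * ‖L y - L z‖ := by
      have h3 : ‖f y - f z‖ ≤ ‖f y - f z - L (y - z)‖ + ‖L (y - z)‖ := by
        simpa using norm_add_le (f y - f z - L (y - z)) (L (y - z))
      rw [map_sub] at h3 h1
      have h4 : 1 + ε ≤ K := by nlinarith [sq_nonneg ((K : ℝ) - 1)]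
      nlinarith [norm_nonneg (L y - L z)]
    rw [edist_dist, edist_dist, dist_eq_norm, dist_eq_norm, ← ENNReal.ofReal_coe_nnreal,
      ← ENNReal.ofReal_mul hK0.le]
    exact ENNReal.ofReal_le_ofReal h2
  have down : ∀ y ∈ W, ∀ z ∈ W, edist (L y) (L z) ≤ K * edist (f y) (f z) := by
    intro y hy z hz
    have h1 := key y hy z hz
    have h2 : ‖L y - L z‖ ≤ K * ‖f y - f z‖ := by
      have h3 : ‖L (y - z)‖ ≤ ‖f y - f z‖ + ‖f y - f z - L (y - z)‖ := by
        simpa using norm_sub_le (f y - f z) (f y - f z - L (y - z))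
      rw [map_sub] at h3 h1
      have h5 : (K : ℝ)⁻¹ * ‖L y - L z‖ ≤ ‖f y - f z‖ := by
        rw [hε] at h1; linarith
      calc ‖L y - L z‖ = K * ((K : ℝ)⁻¹ * ‖L y - L z‖) := by rw [← mul_assoc, hmul, one_mul]
        _ ≤ _ := mul_le_mul_of_nonneg_left h5 hK0.le
    rw [edist_dist, edist_dist, dist_eq_norm, dist_eq_norm, ← ENNReal.ofReal_coe_nnreal,
      ← ENNReal.ofReal_mul hK0.le]
    exact ENNReal.ofReal_le_ofReal h2
  refine ⟨W, hW, fun s hs => ⟨?_, ?_⟩⟩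
  · have := hausdorffMeasure_image_le_of_edist_le (d := n) (Nat.cast_nonneg n)
      fun y hy z hz => up y (hs hy) z (hs hz)
    rwa [lin, ENNReal.rpow_natCast] at this
  · have := hausdorffMeasure_image_le_of_edist_le (d := n) (Nat.cast_nonneg n)
      fun y hy z hz => down y (hs hy) z (hs hz)
    rwa [lin, ENNReal.rpow_natCast] at this

/-- In the exponent `n + 1`, `n` factors come from the distortion of distances and one from
comparing the Jacobian nearby with its value at `x`. -/
theorem exists_nhds_image_comparable_withDensity {f : E n → E m} {x : E n}
    (hf : HasStrictFDerivAt f (fderiv ℝ f x) x) (hL : ∀ v, ‖v‖ ≤ ‖fderiv ℝ f x v‖)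
    (hJ : ContinuousAt (jac f) x) (hJ0 : 0 < jac f x)
    {K : ℝ≥0} (hK : 1 < K) : ∃ W ∈ 𝓝 x, ∀ s ⊆ W, MeasurableSet s →
      Measure.hausdorffMeasure (n : ℝ) (f '' s) ≤
        (K : ℝ≥0∞) ^ (n + 1) *
          ∫⁻ y in s, ENNReal.ofReal (jac f y) ∂Measure.hausdorffMeasure (n : ℝ) ∧
      ∫⁻ y in s, ENNReal.ofReal (jac f y) ∂Measure.hausdorffMeasure (n : ℝ) ≤
        (K : ℝ≥0∞) ^ (n + 1) * Measure.hausdorffMeasure (n : ℝ) (f '' s) := by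
  obtain ⟨W, hW, hWs⟩ := exists_nhds_hausdorffMeasure_image_le hf hL hK
  have hK' : (1 : ℝ) < K := by exact_mod_cast hK
  have hK0 : (0 : ℝ) < K := one_pos.trans hK'
  have h1 : ∀ᶠ y in 𝓝 x, jac f y < K * jac f x :=
    hJ.eventually_lt continuousAt_const (by nlinarith)
  have h2 : ∀ᶠ y in 𝓝 x, jac f x < K * jac f y :=
    continuousAt_const.eventually_lt (continuousAt_const.mul hJ) (by nlinarith)
  have cvt : ∀ {a b : ℝ}, a ≤ K * b → ENNReal.ofReal a ≤ K * ENNReal.ofReal b := by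
    intro a b hab
    rw [← ENNReal.ofReal_coe_nnreal, ← ENNReal.ofReal_mul hK0.le]
    exact ENNReal.ofReal_le_ofReal hab
  refine ⟨W ∩ {y | jac f y < K * jac f x ∧ jac f x < K * jac f y},
    inter_mem hW (h1.and h2), fun s hs hsm => ⟨?_, ?_⟩⟩
  · refine ((hWs s (hs.trans inter_subset_left)).1).trans ?_
    rw [pow_succ, mul_assoc]
    refine mul_le_mul_right ?_ _
    rw [← setLIntegral_const, ← lintegral_const_mul' _ _ (by simp)]
    exact setLIntegral_mono' hsm fun y hy => cvt (hs hy).2.2.le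
  · rw [pow_succ', mul_assoc]
    refine le_trans ?_ (mul_le_mul_right (hWs s (hs.trans inter_subset_left)).2 _)
    rw [← setLIntegral_const, ← lintegral_const_mul' _ _ (by simp)]
    exact setLIntegral_mono' hsm fun y hy => cvt (hs hy).2.1.le

/-- The area formula for an immersion with a measurable left inverse. -/
theorem map_restrict_image_hausdorffMeasure {f : E n → E m} {r : E m → E n} {U : Set (E n)}
    (hU : IsOpen U) (hr : Measurable r) (hrf : ∀ x, r (f x) = x)
    (hf : ∀ x ∈ U, HasStrictFDerivAt f (fderiv ℝ f x) x)
    (hL : ∀ x ∈ U, ∀ v, ‖v‖ ≤ ‖fderiv ℝ f x v‖)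
    (hJ : ContinuousOn (jac f) U) (hJ0 : ∀ x ∈ U, 0 < jac f x) :
    ((Measure.hausdorffMeasure (n : ℝ)).restrict (f '' U)).map r =
      ((Measure.hausdorffMeasure (n : ℝ)).restrict U).withDensity
        fun x => ENNReal.ofReal (jac f x) := by
  set ν := ((Measure.hausdorffMeasure (n : ℝ)).restrict (f '' U)).map r with hν
  set μ := ((Measure.hausdorffMeasure (n : ℝ)).restrict U).withDensity
    (fun x => ENNReal.ofReal (jac f x)) with hμ
  have hνs : ∀ s, MeasurableSet s → ν s = Measure.hausdorffMeasure (n : ℝ) (f '' (s ∩ U)) := by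
    intro s hs
    rw [hν, Measure.map_apply hr hs, Measure.restrict_apply (hr hs)]
    congr 1
    ext p
    constructor
    · rintro ⟨hp, x, hx, rfl⟩
      exact ⟨x, ⟨by simpa [hrf] using hp, hx⟩, rfl⟩
    · rintro ⟨x, ⟨hxs, hxU⟩, rfl⟩
      exact ⟨by simpa [hrf] using hxs, x, hxU, rfl⟩
  have hμs : ∀ s, MeasurableSet s → μ s =
      ∫⁻ y in s ∩ U, ENNReal.ofReal (jac f y) ∂Measure.hausdorffMeasure (n : ℝ) := by
    intro s hs
    rw [hμ, withDensity_apply _ hs, Measure.restrict_restrict hs]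
  have hcomp : ∀ K : ℝ≥0, 1 < K → ∀ x ∈ U, ∃ W ∈ 𝓝 x, ∀ s ⊆ W, MeasurableSet s →
      ν s ≤ ((K : ℝ≥0∞) ^ (n + 1) • μ) s ∧ μ s ≤ ((K : ℝ≥0∞) ^ (n + 1) • ν) s := by
    intro K hK x hx
    obtain ⟨W, hW, hWs⟩ := exists_nhds_image_comparable_withDensity (hf x hx) (hL x hx)
      (hJ.continuousAt (hU.mem_nhds hx)) (hJ0 x hx) hK
    refine ⟨W, hW, fun s hs hsm => ?_⟩
    simpa [hνs s hsm, hμs s hsm] using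
      hWs (s ∩ U) (inter_subset_left.trans hs) (hsm.inter hU.measurableSet)
  refine le_antisymm ?_ ?_
  · refine measure_le_of_forall_one_lt (n + 1) fun K hK => ?_
    refine measure_le_of_locally_le (U := U) ?_ fun x hx => ?_
    · simp [hνs _ hU.measurableSet.compl]
    · obtain ⟨W, hW, h⟩ := hcomp K hK x hx
      exact ⟨W, hW, fun s hs hsm => (h s hs hsm).1⟩
  · refine measure_le_of_forall_one_lt (n + 1) fun K hK => ?_
    refine measure_le_of_locally_le (U := U) ?_ fun x hx => ?_
    · simp [hμs _ hU.measurableSet.compl]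
    · obtain ⟨W, hW, h⟩ := hcomp K hK x hx
      exact ⟨W, hW, fun s hs hsm => (h s hs hsm).2⟩

end AreaFormula

/-! ### Integrals of functions vanishing outside a compact subset. -/

section CompactSupport

variable {n : ℕ} {M : Type*} [NormedAddCommGroup M] [NormedSpace ℝ M]

theorem integrableOn_of_continuousOn_of_eq_zero {g : E n → ℝ} {U K : Set (E n)} (hU : IsOpen U)
    (hK : IsCompact K) (hKU : K ⊆ U) (hg : ContinuousOn g U) (h0 : ∀ x ∈ U, x ∉ K → g x = 0)
    (μ : Measure (E n)) [IsFiniteMeasureOnCompacts μ] : IntegrableOn g U μ :=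
  IntegrableOn.of_forall_sdiff_eq_zero ((hg.mono hKU).integrableOn_compact hK) hU.measurableSet
    fun x hx => h0 x hx.1 hx.2

/-- Extended by zero, `g` is `C¹` with compact support on the whole space, and integration by parts
against the constant `1` applies. No regularity of the boundary of `U` enters. -/
theorem setIntegral_fderiv_eq_zero {g : E n → ℝ} {U K : Set (E n)} (hU : IsOpen U)
    (hK : IsCompact K) (hKU : K ⊆ U) (hg : ContDiffOn ℝ 1 g U) (h0 : ∀ x ∈ U, x ∉ K → g x = 0)
    (μ : Measure (E n)) [μ.IsAddHaarMeasure] (v : E n) :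
    ∫ x in U, fderiv ℝ g x v ∂μ = 0 := by
  set G := U.indicator g
  have hGU : ∀ x ∈ U, G =ᶠ[𝓝 x] g := fun x hx => by
    filter_upwards [hU.mem_nhds hx] with y hy using indicator_of_mem hy g
  have hGK : ∀ x ∉ K, G =ᶠ[𝓝 x] 0 := fun x hx => by
    filter_upwards [hK.isClosed.isOpen_compl.mem_nhds hx] with y hy
    by_cases hyU : y ∈ U
    · simp [G, hyU, h0 y hyU hy]
    · simp [G, hyU]
  have hGd : ContDiff ℝ 1 G := contDiff_iff_contDiffAt.2 fun x => by
    by_cases hx : x ∈ K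
    · exact (hg.contDiffAt (hU.mem_nhds (hKU hx))).congr_of_eventuallyEq (hGU x (hKU hx))
    · exact (contDiffAt_const (c := (0 : ℝ))).congr_of_eventuallyEq (hGK x hx)
  have hsupp : HasCompactSupport G := HasCompactSupport.intro hK fun x hx => (hGK x hx).self_of_nhds
  have hdsupp : HasCompactSupport fun x => fderiv ℝ G x v :=
    HasCompactSupport.intro hK fun x hx => by
      rw [(hGK x hx).fderiv_eq]; simp
  have hdc : Continuous fun x => fderiv ℝ G x v :=
    (hGd.continuous_fderiv one_ne_zero).clm_apply continuous_const
  have hint := integral_mul_fderiv_eq_neg_fderiv_mul_of_integrable (μ := μ) (v := v)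
    (f := fun _ : E n => (1 : ℝ)) (g := G) (by simp)
    (by simpa using hdc.integrable_of_hasCompactSupport hdsupp)
    (by simpa using hGd.continuous.integrable_of_hasCompactSupport hsupp)
    (fun x _ => differentiableAt_const _) (fun x _ => hGd.differentiable one_ne_zero x)
  simp only [one_mul, fderiv_fun_const, Pi.zero_apply, zero_apply, zero_mul,
    integral_zero, neg_zero] at hint
  have hout : ∀ x ∉ U, fderiv ℝ G x v = 0 := fun x hx => by
    rw [(hGK x fun h => hx (hKU h)).fderiv_eq]; simp
  rw [← hint, ← setIntegral_eq_integral_of_forall_compl_eq_zero hout]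
  exact setIntegral_congr_fun hU.measurableSet fun x hx => by
    simp only [(hGU x hx).fderiv_eq]

end CompactSupport

/-! ### Calculus of partial derivatives. -/

section PartialDerivatives

variable {n m : ℕ} {M : Type*} [NormedAddCommGroup M] [NormedSpace ℝ M]

/-- The `i`-th coordinate vector. -/
noncomputable def cvec (i : Fin n) : E n := EuclideanSpace.single i 1

/-- The `i`-th partial derivative. -/
noncomputable def pd (i : Fin n) (f : E n → M) (x : E n) : M := fderiv ℝ f x (cvec i)

theorem sum_smul_cvec (u : E n) : ∑ i, u i • cvec i = u := by
  ext j
  simp [cvec, Pi.single_apply]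

theorem ContDiffOn.differentiableAt_of_isOpen {f : E n → M} {U : Set (E n)} {x : E n}
    (hf : ContDiffOn ℝ ∞ f U) (hU : IsOpen U) (hx : x ∈ U) : DifferentiableAt ℝ f x :=
  (hf.contDiffAt (hU.mem_nhds hx)).differentiableAt (by simp)

theorem contDiffOn_fderiv {f : E n → M} {U : Set (E n)} (hf : ContDiffOn ℝ ∞ f U)
    (hU : IsOpen U) : ContDiffOn ℝ ∞ (fderiv ℝ f) U :=
  hf.fderiv_of_isOpen hU (by simp)

theorem contDiffOn_pd {f : E n → M} {U : Set (E n)} (hf : ContDiffOn ℝ ∞ f U) (hU : IsOpen U)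
    (i : Fin n) : ContDiffOn ℝ ∞ (pd i f) U :=
  (contDiffOn_fderiv hf hU).clm_apply contDiffOn_const

theorem pd_congr {f g : E n → M} {U : Set (E n)} {x : E n} (hU : IsOpen U) (hx : x ∈ U)
    (h : EqOn f g U) (i : Fin n) : pd i f x = pd i g x := by
  rw [pd, pd, (h.eventuallyEq_of_mem (hU.mem_nhds hx)).fderiv_eq]

theorem pd_const (i : Fin n) (c : M) (x : E n) : pd i (fun _ => c) x = 0 := by
  simp [pd]

theorem pd_sub {f g : E n → M} {x : E n} (hf : DifferentiableAt ℝ f x)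
    (hg : DifferentiableAt ℝ g x) (i : Fin n) :
    pd i (fun y => f y - g y) x = pd i f x - pd i g x := by
  simp [pd, fderiv_fun_sub hf hg]

theorem pd_neg (f : E n → M) (x : E n) (i : Fin n) :
    pd i (fun y => - f y) x = - pd i f x := by
  simp [pd, fderiv_fun_neg]

theorem pd_sum {ι : Type*} {s : Finset ι} {f : ι → E n → M} {x : E n}
    (hf : ∀ a ∈ s, DifferentiableAt ℝ (f a) x) (i : Fin n) :
    pd i (fun y => ∑ a ∈ s, f a y) x = ∑ a ∈ s, pd i (f a) x := by
  simp [pd, fderiv_fun_sum hf]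

theorem pd_smul {c : E n → ℝ} {f : E n → M} {x : E n} (hc : DifferentiableAt ℝ c x)
    (hf : DifferentiableAt ℝ f x) (i : Fin n) :
    pd i (fun y => c y • f y) x = c x • pd i f x + pd i c x • f x := by
  simp [pd, fderiv_fun_smul hc hf]

theorem pd_mul {c f : E n → ℝ} {x : E n} (hc : DifferentiableAt ℝ c x)
    (hf : DifferentiableAt ℝ f x) (i : Fin n) :
    pd i (fun y => c y * f y) x = c x * pd i f x + pd i c x * f x := by
  simpa using pd_smul hc hf i

theorem pd_inner {f g : E n → E m} {x : E n} (hf : DifferentiableAt ℝ f x)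
    (hg : DifferentiableAt ℝ g x) (i : Fin n) :
    pd i (fun y => inner ℝ (f y) (g y)) x =
      inner ℝ (f x) (pd i g x) + inner ℝ (pd i f x) (g x) := by
  simp [pd, fderiv_inner_apply ℝ hf hg]

theorem pd_pd_eq {f : E n → M} {U : Set (E n)} {x : E n} (hf : ContDiffOn ℝ ∞ f U)
    (hU : IsOpen U) (hx : x ∈ U) (i j : Fin n) :
    pd i (pd j f) x = fderiv ℝ (fderiv ℝ f) x (cvec i) (cvec j) := by
  have h := ContDiffOn.differentiableAt_of_isOpen (contDiffOn_fderiv hf hU) hU hx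
  change fderiv ℝ (fun y => fderiv ℝ f y (cvec j)) x (cvec i) = _
  rw [fderiv_clm_apply h (differentiableAt_const _)]
  simp

theorem pd_comm {f : E n → M} {U : Set (E n)} {x : E n} (hf : ContDiffOn ℝ ∞ f U)
    (hU : IsOpen U) (hx : x ∈ U) (i j : Fin n) : pd i (pd j f) x = pd j (pd i f) x := by
  rw [pd_pd_eq hf hU hx, pd_pd_eq hf hU hx]
  exact ((hf.contDiffAt (hU.mem_nhds hx)).isSymmSndFDerivAt (by
    rw [minSmoothness_of_isRCLikeNormedField]; exact ENat.LEInfty.out)) _ _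

theorem fderiv_apply_eq_sum (f : E n → M) (x u : E n) :
    fderiv ℝ f x u = ∑ i, u i • pd i f x := by
  conv_lhs => rw [← sum_smul_cvec u]
  simp [pd]

end PartialDerivatives

/-! ### Derivatives of determinants and inverse matrices. -/

section Determinants

variable {n : ℕ} {ι : Type*} [Fintype ι] [DecidableEq ι]

theorem contDiffOn_det {A : E n → Matrix ι ι ℝ} {U : Set (E n)}
    (hA : ∀ a b, ContDiffOn ℝ ∞ (fun x => A x a b) U) : ContDiffOn ℝ ∞ (fun x => (A x).det) U := by
  simp only [Matrix.det_apply']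
  exact ContDiffOn.sum fun σ _ => contDiffOn_const.mul (contDiffOn_prod fun i _ => hA _ _)

theorem contDiffOn_inv_apply {A : E n → Matrix ι ι ℝ} {U : Set (E n)}
    (hA : ∀ a b, ContDiffOn ℝ ∞ (fun x => A x a b) U) (hdet : ∀ x ∈ U, (A x).det ≠ 0) (a b : ι) :
    ContDiffOn ℝ ∞ (fun x => (A x)⁻¹ a b) U := by
  simp only [Matrix.inv_def, Matrix.smul_apply, Matrix.adjugate_apply, Ring.inverse_eq_inv',
    smul_eq_mul]
  refine ((contDiffOn_det hA).inv hdet).mul (contDiffOn_det fun c d => ?_)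
  by_cases hc : c = b
  · simpa [hc] using contDiffOn_const
  · simpa [Matrix.updateRow_ne hc] using hA c d

/-- Along the line `1 + tB` the determinant is `1 + t tr B + t² P(t)` with `P` a polynomial. -/
theorem hasFDerivAt_det_one_apply {D' : (ι → ι → ℝ) →L[ℝ] ℝ}
    (hD : HasFDerivAt (fun A : ι → ι → ℝ => (Matrix.of A).det) D' (Matrix.of.symm 1))
    (B : ι → ι → ℝ) : D' B = (Matrix.of B).trace := by
  set P := (Matrix.det (1 + (Polynomial.X : Polynomial ℝ) •
    (Matrix.of B).map Polynomial.C)).divX.divX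
  have h1 : HasDerivAt (fun t : ℝ => (Matrix.of (Matrix.of.symm 1 + t • B)).det) (D' B) 0 := by
    have hl : HasDerivAt (fun t : ℝ => Matrix.of.symm 1 + t • B) B 0 := by
      simpa using ((hasDerivAt_id (0 : ℝ)).smul_const B).const_add (Matrix.of.symm 1)
    have hD0 : HasFDerivAt (fun A : ι → ι → ℝ => (Matrix.of A).det) D'
        (Matrix.of.symm 1 + (0 : ℝ) • B) := by
      simpa using hD
    exact hD0.comp_hasDerivAt 0 hl
  have h2 : HasDerivAt (fun t : ℝ => (Matrix.of (Matrix.of.symm 1 + t • B)).det)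
      (Matrix.of B).trace 0 := by
    have heq : (fun t : ℝ => (Matrix.of (Matrix.of.symm 1 + t • B)).det) =
        fun t => 1 + (Matrix.of B).trace * t + P.eval t * t ^ 2 :=
      funext fun t => Matrix.det_one_add_smul t (Matrix.of B)
    rw [heq]
    have := (((hasDerivAt_id (0 : ℝ)).const_mul (Matrix.of B).trace).const_add 1).fun_add
      ((P.hasDerivAt 0).fun_mul ((hasDerivAt_id (0 : ℝ)).fun_pow 2))
    simpa using this
  exact h1.unique h2

/-- Jacobi's formula. -/
theorem pd_det {A : E n → Matrix ι ι ℝ} {x : E n}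
    (hA : ∀ a b, DifferentiableAt ℝ (fun y => A y a b) x) (hdet : (A x).det ≠ 0) (i : Fin n) :
    pd i (fun y => (A y).det) x =
      (A x).det * ∑ a, ∑ b, (A x)⁻¹ a b * pd i (fun y => A y b a) x := by
  -- Normalising by `(A x)⁻¹` moves the base point to the identity matrix, the only place where the
  -- derivative of `det` is needed.
  set N : E n → ι → ι → ℝ := fun y => (A x)⁻¹ * A y
  have hNx : N x = Matrix.of.symm 1 := Matrix.nonsing_inv_mul _ (Ne.isUnit hdet)
  have hNab : ∀ a b, (fun y => N y a b) = fun y => ∑ c, (A x)⁻¹ a c * A y c b := fun a b =>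
    funext fun y => Matrix.mul_apply
  have hNd : ∀ a b, DifferentiableAt ℝ (fun y => N y a b) x := fun a b => by
    rw [hNab]
    exact DifferentiableAt.fun_sum fun c _ => (hA c b).const_mul _
  have hN : DifferentiableAt ℝ N x :=
    differentiableAt_pi.2 fun a => differentiableAt_pi.2 fun b => hNd a b
  have hD : DifferentiableAt ℝ (fun B : ι → ι → ℝ => (Matrix.of B).det) (N x) := by
    simp only [Matrix.det_apply', Matrix.of_apply]
    fun_prop
  have hDN := hD.hasFDerivAt
  have hpd : ∀ a b, pd i N x a b = pd i (fun y => N y a b) x := fun a b => by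
    have h1 := hasFDerivAt_pi'.1 hN.hasFDerivAt a
    have h2 := hasFDerivAt_pi'.1 h1 b
    rw [pd, pd, h2.fderiv]
    simp
  have hfac : (fun y => (A y).det) = fun y => (A x).det * (Matrix.of (N y)).det := by
    funext y
    have : (Matrix.of (N y)).det = ((A x)⁻¹ * A y).det := rfl
    rw [this, Matrix.det_mul, ← mul_assoc, ← Matrix.det_mul,
      Matrix.mul_nonsing_inv _ (Ne.isUnit hdet), Matrix.det_one, one_mul]
  have hcomp : HasFDerivAt (fun y => (A x).det * (Matrix.of (N y)).det) _ x :=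
    (hDN.comp x hN.hasFDerivAt).const_mul (A x).det
  rw [hfac, pd, hcomp.fderiv]
  rw [hNx] at hDN ⊢
  have key := hasFDerivAt_det_one_apply hDN (pd i N x)
  simp only [smul_apply, smul_eq_mul]
  congr 1
  refine key.trans ?_
  refine Finset.sum_congr rfl fun a _ => ?_
  rw [Matrix.diag_apply, Matrix.of_apply, hpd, hNab, pd_sum fun c _ => (hA c a).const_mul _]
  refine Finset.sum_congr rfl fun c _ => ?_
  rw [pd_mul (differentiableAt_const _) (hA c a), pd_const]
  simp

/-- The derivative of the inverse matrix. -/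
theorem pd_inv_apply {A : E n → Matrix ι ι ℝ} {U : Set (E n)} (hU : IsOpen U)
    (hA : ∀ a b, ContDiffOn ℝ ∞ (fun x => A x a b) U) (hdet : ∀ x ∈ U, (A x).det ≠ 0)
    {x : E n} (hx : x ∈ U) (i : Fin n) (a d : ι) :
    pd i (fun y => (A y)⁻¹ a d) x =
      - ∑ b, ∑ c, (A x)⁻¹ a b * pd i (fun y => A y b c) x * (A x)⁻¹ c d := by
  set B : Matrix ι ι ℝ := Matrix.of fun a b => pd i (fun y => (A y)⁻¹ a b) x with hB
  set C : Matrix ι ι ℝ := Matrix.of fun a b => pd i (fun y => A y a b) x with hC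
  have hdA := fun a b => ContDiffOn.differentiableAt_of_isOpen (hA a b) hU hx
  have hdI := fun a b => ContDiffOn.differentiableAt_of_isOpen
    (contDiffOn_inv_apply hA hdet a b) hU hx
  -- This is the derivative of `A⁻¹ A = 1`.
  have h0 : B * A x + (A x)⁻¹ * C = 0 := by
    ext a c
    have h1 : EqOn (fun y => ∑ b, (A y)⁻¹ a b * A y b c) (fun _ => (1 : Matrix ι ι ℝ) a c) U := by
      intro y hy
      have := Matrix.nonsing_inv_mul (A y) (Ne.isUnit (hdet y hy))
      simp only [← this, Matrix.mul_apply]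
    have h2 := pd_congr hU hx h1 i
    rw [pd_const, pd_sum fun b _ => (hdI a b).fun_mul (hdA b c)] at h2
    simp only [Matrix.add_apply, Matrix.mul_apply, Matrix.zero_apply, ← Finset.sum_add_distrib]
    rw [← h2]
    refine Finset.sum_congr rfl fun b _ => ?_
    rw [pd_mul (hdI a b) (hdA b c), hB, hC]
    simp only [Matrix.of_apply]
    ring
  have h3 : B = - ((A x)⁻¹ * C * (A x)⁻¹) := by
    have h4 : B * A x = - ((A x)⁻¹ * C) := eq_neg_of_add_eq_zero_left h0
    calc B = B * A x * (A x)⁻¹ := by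
          rw [Matrix.mul_assoc, Matrix.mul_nonsing_inv _ (Ne.isUnit (hdet x hx)), Matrix.mul_one]
      _ = _ := by rw [h4, Matrix.neg_mul]
  have h5 : B a d = - ((A x)⁻¹ * C * (A x)⁻¹) a d := by rw [h3]; rfl
  change B a d = _
  rw [h5, Matrix.mul_apply, Finset.sum_comm]
  simp only [Matrix.mul_apply, Finset.sum_mul]
  rfl

end Determinants

/-! ### Coordinate geometry of an immersion: Christoffel symbols and second fundamental form. -/

section Immersions

variable {n m : ℕ}

/-- The matrix of the induced metric in coordinates. -/
noncomputable def metric (f : E n → E m) (x : E n) : Matrix (Fin n) (Fin n) ℝ :=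
  Matrix.of fun i j => inner ℝ (pd i f x) (pd j f x)

/-- `f` is a smooth immersion on the open set `U`. -/
structure IsImmersionOn (f : E n → E m) (U : Set (E n)) : Prop where
  isOpen : IsOpen U
  smooth : ContDiffOn ℝ ∞ f U
  det_ne : ∀ x ∈ U, (metric f x).det ≠ 0

/-- The tangent vector dual to the `a`-th coordinate. -/
noncomputable def dualVec (f : E n → E m) (a : Fin n) (x : E n) : E m :=
  ∑ b, (metric f x)⁻¹ a b • pd b f x

/-- The Christoffel symbol `Γᶜᵢⱼ`. -/
noncomputable def chr (f : E n → E m) (c i j : Fin n) (x : E n) : ℝ :=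
  inner ℝ (pd i (pd j f) x) (dualVec f c x)

/-- The normal part of `v` in coordinates. -/
noncomputable def nproj (f : E n → E m) (x : E n) (v : E m) : E m :=
  v - ∑ a, inner ℝ v (dualVec f a x) • pd a f x

/-- The components of the second fundamental form. -/
noncomputable def sff (f : E n → E m) (i j : Fin n) (x : E n) : E m :=
  nproj f x (pd i (pd j f) x)

theorem metric_comm (f : E n → E m) (x : E n) (i j : Fin n) : metric f x i j = metric f x j i := by
  simp only [metric, Matrix.of_apply]
  exact real_inner_comm _ _

theorem metric_inv_comm (f : E n → E m) (x : E n) (i j : Fin n) :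
    (metric f x)⁻¹ i j = (metric f x)⁻¹ j i := by
  have h : (metric f x).transpose = metric f x := by
    ext a b
    exact metric_comm f x b a
  conv_lhs => rw [← h, ← Matrix.transpose_nonsing_inv]
  rfl

variable {f : E n → E m} {U : Set (E n)} {x : E n}

namespace IsImmersionOn

variable (hf : IsImmersionOn f U) (hx : x ∈ U)
include hf

theorem contDiffOn_pd (i : Fin n) : ContDiffOn ℝ ∞ (pd i f) U :=
  FlatGraph.contDiffOn_pd hf.smooth hf.isOpen i

theorem contDiffOn_pd_pd (i j : Fin n) : ContDiffOn ℝ ∞ (pd i (pd j f)) U :=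
  FlatGraph.contDiffOn_pd (hf.contDiffOn_pd j) hf.isOpen i

theorem contDiffOn_metric (i j : Fin n) : ContDiffOn ℝ ∞ (fun y => metric f y i j) U :=
  (hf.contDiffOn_pd i).inner ℝ (hf.contDiffOn_pd j)

theorem contDiffOn_metric_inv (i j : Fin n) : ContDiffOn ℝ ∞ (fun y => (metric f y)⁻¹ i j) U :=
  contDiffOn_inv_apply hf.contDiffOn_metric hf.det_ne i j

theorem contDiffOn_dualVec (a : Fin n) : ContDiffOn ℝ ∞ (dualVec f a) U :=
  ContDiffOn.sum fun b _ => (hf.contDiffOn_metric_inv a b).smul (hf.contDiffOn_pd b)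

theorem contDiffOn_chr (c i j : Fin n) : ContDiffOn ℝ ∞ (chr f c i j) U :=
  (hf.contDiffOn_pd_pd i j).inner ℝ (hf.contDiffOn_dualVec c)

theorem contDiffOn_nproj {η : E n → E m} (hη : ContDiffOn ℝ ∞ η U) :
    ContDiffOn ℝ ∞ (fun y => nproj f y (η y)) U :=
  hη.sub (ContDiffOn.sum fun a _ =>
    (hη.inner ℝ (hf.contDiffOn_dualVec a)).smul (hf.contDiffOn_pd a))

theorem contDiffOn_sff (i j : Fin n) : ContDiffOn ℝ ∞ (sff f i j) U :=
  hf.contDiffOn_nproj (hf.contDiffOn_pd_pd i j)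

include hx

theorem diffAt {M : Type*} [NormedAddCommGroup M] [NormedSpace ℝ M] {g : E n → M}
    (hg : ContDiffOn ℝ ∞ g U) : DifferentiableAt ℝ g x :=
  ContDiffOn.differentiableAt_of_isOpen hg hf.isOpen hx

theorem metric_inv_mul (a b : Fin n) :
    ∑ c, (metric f x)⁻¹ a c * metric f x c b = if a = b then 1 else 0 := by
  rw [← Matrix.mul_apply, Matrix.nonsing_inv_mul _ (Ne.isUnit (hf.det_ne x hx)), Matrix.one_apply]

theorem inner_dualVec_pd (a b : Fin n) :
    inner ℝ (dualVec f a x) (pd b f x) = if a = b then 1 else 0 := by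
  rw [← hf.metric_inv_mul hx a b]
  simp [dualVec, sum_inner, real_inner_smul_left, metric]

theorem inner_nproj_pd (v : E m) (b : Fin n) : inner ℝ (nproj f x v) (pd b f x) = 0 := by
  have h : ∀ v, ∑ a, inner ℝ v (dualVec f a x) * metric f x a b = inner ℝ v (pd b f x) := by
    intro v
    have h1 : ∑ a, metric f x b a • dualVec f a x = pd b f x := by
      have h2 : metric f x * (metric f x)⁻¹ = 1 :=
        Matrix.mul_nonsing_inv _ (Ne.isUnit (hf.det_ne x hx))
      simp only [dualVec, Finset.smul_sum, smul_smul]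
      rw [Finset.sum_comm]
      simp only [← Finset.sum_smul, ← Matrix.mul_apply, h2, Matrix.one_apply, ite_smul, one_smul,
        zero_smul, Finset.sum_ite_eq, Finset.mem_univ, if_true]
    rw [← h1, inner_sum]
    refine Finset.sum_congr rfl fun a _ => ?_
    rw [real_inner_smul_right, metric_comm, mul_comm]
  rw [nproj, inner_sub_left, sum_inner, sub_eq_zero, ← h v]
  refine Finset.sum_congr rfl fun a _ => ?_
  rw [real_inner_smul_left]
  rfl

omit hf hx in
theorem inner_dualVec_eq (v : E m) (a : Fin n) :
    inner ℝ v (dualVec f a x) = ∑ b, (metric f x)⁻¹ a b * inner ℝ v (pd b f x) := by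
  simp [dualVec, inner_sum, real_inner_smul_right]

omit hf hx in
theorem inner_dualVec_eq_zero {v : E m} (hv : ∀ b, inner ℝ v (pd b f x) = 0) (a : Fin n) :
    inner ℝ v (dualVec f a x) = 0 := by
  simp [inner_dualVec_eq, hv]

omit hf hx in
theorem nproj_eq_self {v : E m} (hv : ∀ b, inner ℝ v (pd b f x) = 0) : nproj f x v = v := by
  simp [nproj, inner_dualVec_eq_zero hv]

theorem nproj_nproj (v : E m) : nproj f x (nproj f x v) = nproj f x v :=
  nproj_eq_self (hf.inner_nproj_pd hx v)

omit hf hx in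
theorem inner_nproj_of_normal {w : E m} (hw : ∀ b, inner ℝ w (pd b f x) = 0) (v : E m) :
    inner ℝ (nproj f x v) w = inner ℝ v w := by
  rw [nproj, inner_sub_left, sum_inner]
  have hw' : ∀ b, inner ℝ (pd b f x) w = 0 := fun b => by rw [real_inner_comm, hw]
  simp [real_inner_smul_left, hw']

theorem inner_nproj_comm (v w : E m) :
    inner ℝ (nproj f x v) w = inner ℝ v (nproj f x w) := by
  rw [← inner_nproj_of_normal (hf.inner_nproj_pd hx w) v, real_inner_comm,
    ← inner_nproj_of_normal (hf.inner_nproj_pd hx v) w, real_inner_comm]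

omit hf hx in
theorem mem_normalSpace_iff {v : E m} :
    v ∈ normalSpace f x ↔ ∀ b, inner ℝ v (pd b f x) = 0 := by
  rw [normalSpace, Submodule.mem_orthogonal']
  constructor
  · intro h b
    exact h _ ⟨cvec b, rfl⟩
  · rintro h _ ⟨u, rfl⟩
    change inner ℝ v (fderiv ℝ f x u) = 0
    rw [fderiv_apply_eq_sum]
    simp [inner_sum, real_inner_smul_right, h]

/-- The vector `nproj f x v` is normal and differs from `v` by a tangent vector; this identifies the
abstract projection with an expression that can be differentiated in coordinates. -/
theorem normalProj_eq (v : E m) : normalProj f x v = nproj f x v := by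
  refine Submodule.eq_starProjection_of_mem_orthogonal (K := normalSpace f x)
    (mem_normalSpace_iff.2 (hf.inner_nproj_pd hx v)) ?_
  rw [normalSpace, Submodule.orthogonal_orthogonal, nproj, sub_sub_cancel]
  exact Submodule.sum_mem _ fun a _ => Submodule.smul_mem _ _ ⟨cvec a, rfl⟩

theorem pd_pd_comm (i j : Fin n) : pd i (pd j f) x = pd j (pd i f) x :=
  pd_comm hf.smooth hf.isOpen hx i j

theorem chr_comm (c i j : Fin n) : chr f c i j x = chr f c j i x := by
  rw [chr, chr, hf.pd_pd_comm hx]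

theorem sff_comm (i j : Fin n) : sff f i j x = sff f j i x := by
  rw [sff, sff, hf.pd_pd_comm hx]

omit hf hx in
theorem pd_pd_eq_sff_add (i j : Fin n) :
    pd i (pd j f) x = sff f i j x + ∑ c, chr f c i j x • pd c f x := by
  simp [sff, nproj, chr]

theorem secondFundamentalForm_eq (u v : E n) :
    secondFundamentalForm f x u v = ∑ i, ∑ j, (u i * v j) • sff f i j x := by
  have h := hf.diffAt hx (contDiffOn_fderiv hf.smooth hf.isOpen)
  have h1 : fderiv ℝ (fun y => fderiv ℝ f y v) x u = ∑ i, ∑ j, (u i * v j) • pd i (pd j f) x := by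
    rw [fderiv_clm_apply h (differentiableAt_const _)]
    simp only [fderiv_fun_const, Pi.zero_apply, ContinuousLinearMap.comp_zero, zero_add,
      ContinuousLinearMap.flip_apply]
    conv_lhs => rw [← sum_smul_cvec u, ← sum_smul_cvec v]
    simp only [pd_pd_eq hf.smooth hf.isOpen hx, map_sum, map_smul, sum_apply, smul_apply,
      Finset.smul_sum, smul_smul]
    rw [Finset.sum_comm]
    exact Finset.sum_congr rfl fun i _ => Finset.sum_congr rfl fun j _ => by rw [mul_comm]
  rw [secondFundamentalForm, h1, map_sum]
  refine Finset.sum_congr rfl fun i _ => ?_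
  rw [map_sum]
  refine Finset.sum_congr rfl fun j _ => ?_
  rw [map_smul, hf.normalProj_eq hx, sff]

theorem pd_metric (k b c : Fin n) :
    pd k (fun y => metric f y b c) x =
      inner ℝ (pd k (pd b f) x) (pd c f x) + inner ℝ (pd k (pd c f) x) (pd b f x) := by
  have := pd_inner (hf.diffAt hx (hf.contDiffOn_pd b)) (hf.diffAt hx (hf.contDiffOn_pd c)) k
  rw [add_comm, real_inner_comm (pd k (pd c f) x)] at this
  exact this

/-- In `∂g⁻¹ = -g⁻¹ (∂g) g⁻¹`, the product rule splits `∂g` into two terms, each giving one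
Christoffel sum. -/
theorem pd_metric_inv (k a d : Fin n) :
    pd k (fun y => (metric f y)⁻¹ a d) x =
      - ∑ c, (metric f x)⁻¹ a c * chr f d k c x - ∑ c, (metric f x)⁻¹ d c * chr f a k c x := by
  rw [pd_inv_apply hf.isOpen hf.contDiffOn_metric hf.det_ne hx]
  simp only [hf.pd_metric hx, mul_add, add_mul, Finset.sum_add_distrib, neg_add, sub_eq_add_neg]
  congr 2
  · refine Finset.sum_congr rfl fun b _ => ?_
    rw [chr, inner_dualVec_eq, Finset.mul_sum]
    refine Finset.sum_congr rfl fun c _ => ?_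
    rw [metric_inv_comm f x c d]
    ring
  · rw [Finset.sum_comm]
    refine Finset.sum_congr rfl fun b _ => ?_
    rw [chr, inner_dualVec_eq, Finset.mul_sum]
    refine Finset.sum_congr rfl fun c _ => ?_
    rw [metric_inv_comm f x b d]
    ring

theorem pd_det_metric (k : Fin n) :
    pd k (fun y => (metric f y).det) x = (metric f x).det * (2 * ∑ a, chr f a k a x) := by
  rw [pd_det (fun a b => hf.diffAt hx (hf.contDiffOn_metric a b)) (hf.det_ne x hx)]
  congr 1
  simp only [hf.pd_metric hx, mul_add, Finset.sum_add_distrib, two_mul]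
  congr 1
  · rw [Finset.sum_comm]
    refine Finset.sum_congr rfl fun b _ => ?_
    rw [chr, inner_dualVec_eq]
    refine Finset.sum_congr rfl fun c _ => ?_
    rw [metric_inv_comm]
  · refine Finset.sum_congr rfl fun b _ => ?_
    rw [chr, inner_dualVec_eq]

theorem pd_dualVec (k a : Fin n) :
    pd k (dualVec f a) x = ∑ b, (metric f x)⁻¹ a b • sff f k b x
      - ∑ c, (∑ b, (metric f x)⁻¹ c b * chr f a k b x) • pd c f x := by
  have h1 : pd k (dualVec f a) x = ∑ b, ((metric f x)⁻¹ a b • pd k (pd b f) x +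
      pd k (fun y => (metric f y)⁻¹ a b) x • pd b f x) := by
    have := pd_sum (s := Finset.univ) (f := fun b y => (metric f y)⁻¹ a b • pd b f y) (x := x)
      (fun b _ => (hf.diffAt hx (hf.contDiffOn_metric_inv a b)).smul
        (hf.diffAt hx (hf.contDiffOn_pd b))) k
    refine this.trans (Finset.sum_congr rfl fun b _ => ?_)
    exact pd_smul (hf.diffAt hx (hf.contDiffOn_metric_inv a b))
      (hf.diffAt hx (hf.contDiffOn_pd b)) k
  rw [h1]
  simp only [hf.pd_metric_inv hx, pd_pd_eq_sff_add k, smul_add, Finset.sum_add_distrib,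
    sub_smul, Finset.sum_sub_distrib, neg_smul, Finset.sum_neg_distrib]
  -- The tangential part of `∂ₖ∂_b f` cancels one of the two Christoffel sums in `∂ₖg⁻¹`.
  have h2 : ∑ b, (metric f x)⁻¹ a b • ∑ c, chr f c k b x • pd c f x =
      ∑ b, (∑ c, (metric f x)⁻¹ a c * chr f b k c x) • pd b f x := by
    simp only [Finset.smul_sum, smul_smul, Finset.sum_smul]
    exact Finset.sum_comm
  rw [h2]
  abel

theorem inner_sff_pd (i j b : Fin n) : inner ℝ (sff f i j x) (pd b f x) = 0 :=
  hf.inner_nproj_pd hx _ b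

omit hf hx in
theorem inner_pd_pd_of_normal {w : E m} (hw : ∀ b, inner ℝ w (pd b f x) = 0) (i j : Fin n) :
    inner ℝ (pd i (pd j f) x) w = inner ℝ (sff f i j x) w :=
  (inner_nproj_of_normal hw _).symm

/-- Antisymmetrised in `k` and `i`, this is the Gauss equation: the third derivatives drop out,
leaving the curvature on one side and products of `A` on the other. -/
theorem pd_chr (k a i j : Fin n) :
    pd k (chr f a i j) x = inner ℝ (pd k (pd i (pd j f)) x) (dualVec f a x)
      + ∑ b, (metric f x)⁻¹ a b * inner ℝ (sff f i j x) (sff f k b x)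
      - ∑ b, chr f a k b x * chr f b i j x := by
  have h := pd_inner (hf.diffAt hx (hf.contDiffOn_pd_pd i j))
    (hf.diffAt hx (hf.contDiffOn_dualVec a)) k
  change pd k (chr f a i j) x = _ at h
  rw [h, hf.pd_dualVec hx, inner_sub_right, inner_sum, inner_sum]
  simp only [real_inner_smul_right]
  have h1 : ∀ b, inner ℝ (pd i (pd j f) x) (sff f k b x) =
      inner ℝ (sff f i j x) (sff f k b x) := fun b =>
    inner_pd_pd_of_normal (hf.inner_sff_pd hx k b) i j
  have h2 : ∑ c, (∑ b, (metric f x)⁻¹ c b * chr f a k b x) * inner ℝ (pd i (pd j f) x) (pd c f x)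
      = ∑ b, chr f a k b x * chr f b i j x := by
    simp only [Finset.sum_mul]
    rw [Finset.sum_comm]
    refine Finset.sum_congr rfl fun b _ => ?_
    rw [chr, chr, inner_dualVec_eq (pd i (pd j f) x), Finset.mul_sum]
    refine Finset.sum_congr rfl fun c _ => ?_
    rw [metric_inv_comm]
    ring
  rw [h2]
  simp only [h1]
  ring

end IsImmersionOn

end Immersions

/-! ### The Ricci equation. -/

section Flatness

variable {n m : ℕ} {f : E n → E m} {U : Set (E n)} {x : E n}

/-- The Ricci equation: if the normal bundle is flat, the shape operators commute. -/
theorem IsImmersionOn.sum_sff_mul_sff_comm (hf : IsImmersionOn f U) (hx : x ∈ U)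
    (hflat : FlatNormalBundle f U) (i j : Fin n) (p q : E m) :
    ∑ a, ∑ b, (metric f x)⁻¹ a b * (inner ℝ (sff f j b x) p * inner ℝ (sff f i a x) q) =
      ∑ a, ∑ b, (metric f x)⁻¹ a b * (inner ℝ (sff f i b x) p * inner ℝ (sff f j a x) q) := by
  -- Flatness is tested on commuting coordinate fields and on the normal part of a constant vector
  -- `p`, then paired with the normal part of `q`.
  set ζ : E n → E m := fun y => nproj f y p with hζ
  have hζs : ContDiffOn ℝ ∞ ζ U := hf.contDiffOn_nproj contDiffOn_const
  have hR := hflat (fun _ => cvec i) (fun _ => cvec j) ζ contDiffOn_const contDiffOn_const hζs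
    (fun y hy => IsImmersionOn.mem_normalSpace_iff.2 (hf.inner_nproj_pd hy p)) x hx
  have hη : ∀ l, EqOn (fun y => normalDeriv f ζ y (cvec l))
      (fun y => pd l ζ y - ∑ a, inner ℝ (pd l ζ y) (dualVec f a y) • pd a f y) U :=
    fun l y hy => hf.normalProj_eq hy _
  have hs : ∀ l a, ContDiffOn ℝ ∞ (fun y => inner ℝ (pd l ζ y) (dualVec f a y)) U := fun l a =>
    (FlatGraph.contDiffOn_pd hζs hf.isOpen l).inner ℝ (hf.contDiffOn_dualVec a)
  set d : E m := nproj f x q with hd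
  have hdn : ∀ b, inner ℝ d (pd b f x) = 0 := hf.inner_nproj_pd hx q
  have hdn' : ∀ b, inner ℝ (pd b f x) d = 0 := fun b => by rw [real_inner_comm, hdn]
  -- The Weingarten relation: differentiate `⟨ζ, ∂_b f⟩ = 0`.
  have hcoef : ∀ l a, inner ℝ (pd l ζ x) (dualVec f a x) =
      - ∑ b, (metric f x)⁻¹ a b * inner ℝ (sff f l b x) p := by
    intro l a
    rw [IsImmersionOn.inner_dualVec_eq, ← Finset.sum_neg_distrib]
    refine Finset.sum_congr rfl fun b _ => ?_
    have h0 : EqOn (fun y => inner ℝ (ζ y) (pd b f y)) (fun _ => (0 : ℝ)) U := fun y hy =>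
      hf.inner_nproj_pd hy p b
    have h1 := pd_congr hf.isOpen hx h0 l
    rw [pd_const, pd_inner (hf.diffAt hx hζs) (hf.diffAt hx (hf.contDiffOn_pd b))] at h1
    have h2 : inner ℝ (ζ x) (pd l (pd b f) x) = inner ℝ (sff f l b x) p := by
      rw [hζ, hf.inner_nproj_comm hx, real_inner_comm, sff]
    rw [← h2]
    linear_combination (metric f x)⁻¹ a b * h1
  -- Against the normal vector `d`, the tangential part removed from `∂ₗζ` contributes only through
  -- the derivatives of the `∂_a f`, which produce `A`. The remaining term is symmetric in `k` and
  -- `l`.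
  have hmain : ∀ k l, inner ℝ (normalDeriv f (fun y => normalDeriv f ζ y (cvec l)) x (cvec k)) d =
      inner ℝ (pd k (pd l ζ) x) d +
        ∑ a, ∑ b, (metric f x)⁻¹ a b * (inner ℝ (sff f l b x) p * inner ℝ (sff f k a x) q) := by
    intro k l
    rw [normalDeriv, hf.normalProj_eq hx, IsImmersionOn.inner_nproj_of_normal hdn]
    change inner ℝ (pd k (fun y => normalDeriv f ζ y (cvec l)) x) d = _
    rw [pd_congr hf.isOpen hx (hη l)]
    have hterm : ∀ a, DifferentiableAt ℝ
        (fun y => inner ℝ (pd l ζ y) (dualVec f a y) • pd a f y) x := fun a =>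
      (hf.diffAt hx (hs l a)).fun_smul (hf.diffAt hx (hf.contDiffOn_pd a))
    rw [pd_sub (hf.diffAt hx (FlatGraph.contDiffOn_pd hζs hf.isOpen l))
      (DifferentiableAt.fun_sum fun a _ => hterm a), pd_sum fun a _ => hterm a, inner_sub_left,
      sub_eq_add_neg, sum_inner, ← Finset.sum_neg_distrib]
    congr 1
    refine Finset.sum_congr rfl fun a _ => ?_
    rw [pd_smul (hf.diffAt hx (hs l a)) (hf.diffAt hx (hf.contDiffOn_pd a)), inner_add_left,
      real_inner_smul_left, real_inner_smul_left, hdn', hcoef,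
      IsImmersionOn.inner_pd_pd_of_normal hdn, hd, ← hf.inner_nproj_comm hx, sff,
      hf.nproj_nproj hx, mul_zero, add_zero, neg_mul, neg_neg, Finset.sum_mul]
    exact Finset.sum_congr rfl fun b _ => by ring
  have hbr : normalDeriv f ζ x (VectorField.lieBracket ℝ (fun _ => cvec i) (fun _ => cvec j) x) =
      0 := by
    simp [VectorField.lieBracket, normalDeriv]
  rw [normalCurvature, hbr, sub_zero] at hR
  have hRd : inner ℝ (normalDeriv f (fun y => normalDeriv f ζ y (cvec j)) x (cvec i)) d =
      inner ℝ (normalDeriv f (fun y => normalDeriv f ζ y (cvec i)) x (cvec j)) d := by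
    rw [sub_eq_zero.1 hR]
  rw [hmain, hmain, pd_comm hζs hf.isOpen hx] at hRd
  exact add_left_cancel hRd

end Flatness

/-! ### The traced Gauss equation as an identity between sums. -/

section DivergenceAlgebra

variable {n : ℕ}

/-- The algebraic identity behind the Gauss equation for a graph with flat normal bundle. -/
theorem divergence_identity {gi : Fin n → Fin n → ℝ} {Γ : Fin n → Fin n → Fin n → ℝ}
    {S T dΓ : Fin n → Fin n → Fin n → Fin n → ℝ} {dgi : Fin n → Fin n → Fin n → ℝ}
    (hgi : ∀ a b, gi a b = gi b a) (hΓ : ∀ c i j, Γ c i j = Γ c j i)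
    (hS : ∀ i j k l, S i j k l = S i j l k) (hT : ∀ k i j a, T k i j a = T i k j a)
    (hdgi : ∀ k a b, dgi k a b = - ∑ c, gi a c * Γ b k c - ∑ c, gi b c * Γ a k c)
    (hdΓ : ∀ k a i j, dΓ k a i j =
      T k i j a + ∑ b, gi a b * S i j k b - ∑ b, Γ a k b * Γ b i j)
    (hflat : ∀ i j p q, ∑ a, ∑ b, gi a b * (Γ p j b * Γ q i a) =
      ∑ a, ∑ b, gi a b * (Γ p i b * Γ q j a)) :
    - ∑ i, ∑ j, ∑ a, (gi i j * dΓ i a a j + dgi i i j * Γ a a j) =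
      (∑ i, ∑ j, ∑ k, ∑ l, gi i j * gi k l * S i j k l)
        - (∑ i, ∑ j, ∑ k, ∑ l, gi i k * gi j l * S i j k l)
        - ∑ i, ∑ a, ∑ b, (gi a b * dΓ i i a b + dgi i a b * Γ i a b) := by
  -- Expansion leaves a trace `Q` of third derivatives, the contractions `N` and `HH` of `S`, and
  -- quadratic sums `X`, `Y`, `Z` in `Γ`. By relabelling alone, the two sides differ by `Y - Z`.
  set X := ∑ i, ∑ j, ∑ a, ∑ c, gi i c * Γ j i c * Γ a a j with hX
  set Y := ∑ i, ∑ j, ∑ a, ∑ c, gi j c * Γ i i c * Γ a a j with hY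
  set Z := ∑ i, ∑ a, ∑ b, ∑ c, gi a c * Γ b i c * Γ i a b with hZ
  set Q := ∑ i, ∑ j, ∑ a, gi i j * T i a j a with hQ
  set N := ∑ i, ∑ j, ∑ k, ∑ l, gi i k * gi j l * S i j k l with hN
  set HH := ∑ i, ∑ j, ∑ k, ∑ l, gi i j * gi k l * S i j k l with hHH
  have hL : ∑ i, ∑ j, ∑ a, (gi i j * dΓ i a a j + dgi i i j * Γ a a j) =
      Q + (∑ i, ∑ j, ∑ a, ∑ b, gi i j * (gi a b * S a j i b))
        - (∑ i, ∑ j, ∑ a, ∑ b, gi i j * (Γ a i b * Γ b a j)) - X - Y := by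
    simp only [hdgi, hdΓ, hX, hY, hQ, mul_add, mul_sub, sub_mul, neg_mul, Finset.mul_sum,
      Finset.sum_mul, Finset.sum_add_distrib, Finset.sum_sub_distrib, Finset.sum_neg_distrib]
    ring
  have hR : ∑ i, ∑ a, ∑ b, (gi a b * dΓ i i a b + dgi i a b * Γ i a b) =
      (∑ i, ∑ a, ∑ b, gi a b * T i a b i)
        + (∑ i, ∑ a, ∑ b, ∑ c, gi a b * (gi i c * S a b i c))
        - (∑ i, ∑ a, ∑ b, ∑ c, gi a b * (Γ i i c * Γ c a b))
        - Z - ∑ i, ∑ a, ∑ b, ∑ c, gi b c * Γ a i c * Γ i a b := by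
    simp only [hdgi, hdΓ, hZ, mul_add, mul_sub, sub_mul, neg_mul, Finset.mul_sum,
      Finset.sum_mul, Finset.sum_add_distrib, Finset.sum_sub_distrib, Finset.sum_neg_distrib]
    ring
  have e1 : ∑ i, ∑ j, ∑ a, ∑ b, gi i j * (gi a b * S a j i b) = N := by
    rw [hN]
    calc _ = ∑ i, ∑ j, ∑ a, ∑ b, gi a b * gi j i * S a j b i := by
          refine Finset.sum_congr rfl fun i _ => Finset.sum_congr rfl fun j _ =>
            Finset.sum_congr rfl fun a _ => Finset.sum_congr rfl fun b _ => ?_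
          rw [hS, hgi i j]; ring
      _ = ∑ a, ∑ j, ∑ b, ∑ i, gi a b * gi j i * S a j b i := by
          rw [Finset.sum_comm]
          simp_rw [Finset.sum_comm (s := Finset.univ (α := Fin n)) (t := Finset.univ)
            (f := fun i a => ∑ b, gi a b * gi _ i * S a _ b i)]
          rw [Finset.sum_comm]
          refine Finset.sum_congr rfl fun a _ => Finset.sum_congr rfl fun j _ => ?_
          exact Finset.sum_comm
  have e2 : ∑ i, ∑ j, ∑ a, ∑ b, gi i j * (Γ a i b * Γ b a j) = Z := by
    rw [hZ]
    calc _ = ∑ i, ∑ a, ∑ b, ∑ j, gi i j * (Γ a i b * Γ b a j) := by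
          refine Finset.sum_congr rfl fun i _ => ?_
          rw [Finset.sum_comm]
          refine Finset.sum_congr rfl fun a _ => ?_
          rw [Finset.sum_comm]
      _ = ∑ a, ∑ i, ∑ b, ∑ j, gi i j * (Γ a i b * Γ b a j) := Finset.sum_comm
      _ = _ := by
          refine Finset.sum_congr rfl fun i _ => Finset.sum_congr rfl fun j _ =>
            Finset.sum_congr rfl fun a _ => Finset.sum_congr rfl fun b _ => ?_
          ring
  have e3 : ∑ i, ∑ a, ∑ b, gi a b * T i a b i = Q := by
    rw [hQ]
    calc _ = ∑ a, ∑ i, ∑ b, gi a b * T i a b i := Finset.sum_comm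
      _ = ∑ a, ∑ b, ∑ i, gi a b * T i a b i :=
          Finset.sum_congr rfl fun a _ => Finset.sum_comm
      _ = _ := by
          refine Finset.sum_congr rfl fun i _ => Finset.sum_congr rfl fun j _ =>
            Finset.sum_congr rfl fun a _ => ?_
          rw [hT]
  have e4 : ∑ i, ∑ a, ∑ b, ∑ c, gi a b * (gi i c * S a b i c) = HH := by
    rw [hHH]
    calc _ = ∑ a, ∑ i, ∑ b, ∑ c, gi a b * (gi i c * S a b i c) := Finset.sum_comm
      _ = ∑ a, ∑ b, ∑ i, ∑ c, gi a b * (gi i c * S a b i c) :=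
          Finset.sum_congr rfl fun a _ => Finset.sum_comm
      _ = _ := by simp only [mul_assoc]
  have e5 : ∑ i, ∑ a, ∑ b, ∑ c, gi a b * (Γ i i c * Γ c a b) = X := by
    rw [hX]
    calc _ = ∑ a, ∑ i, ∑ b, ∑ c, gi a b * (Γ i i c * Γ c a b) := Finset.sum_comm
      _ = ∑ a, ∑ i, ∑ c, ∑ b, gi a b * (Γ i i c * Γ c a b) :=
          Finset.sum_congr rfl fun a _ => Finset.sum_congr rfl fun i _ => Finset.sum_comm
      _ = ∑ a, ∑ c, ∑ i, ∑ b, gi a b * (Γ i i c * Γ c a b) :=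
          Finset.sum_congr rfl fun a _ => Finset.sum_comm
      _ = _ := by
          refine Finset.sum_congr rfl fun i _ => Finset.sum_congr rfl fun j _ =>
            Finset.sum_congr rfl fun a _ => Finset.sum_congr rfl fun b _ => ?_
          ring
  have e6 : ∑ i, ∑ a, ∑ b, ∑ c, gi b c * Γ a i c * Γ i a b = Z := by
    rw [hZ]
    refine Finset.sum_congr rfl fun i _ => ?_
    rw [Finset.sum_comm]
    refine Finset.sum_congr rfl fun a _ => Finset.sum_congr rfl fun b _ =>
      Finset.sum_congr rfl fun c _ => ?_
    rw [hΓ i b a]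
  -- The only use of `hflat`: it exchanges the lower indices `i` and `a` between the two contracted
  -- factors `Γ i i c` and `Γ a a j`.
  have e7 : Y = Z := by
    rw [hY, hZ]
    calc _ = ∑ i, ∑ a, ∑ j, ∑ c, gi j c * (Γ i i c * Γ a a j) := by
          refine Finset.sum_congr rfl fun i _ => ?_
          rw [Finset.sum_comm]
          simp only [mul_assoc]
      _ = ∑ i, ∑ a, ∑ j, ∑ c, gi j c * (Γ i a c * Γ a i j) :=
          Finset.sum_congr rfl fun i _ => Finset.sum_congr rfl fun a _ => hflat a i i a
      _ = ∑ a, ∑ i, ∑ j, ∑ c, gi j c * (Γ i a c * Γ a i j) := Finset.sum_comm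
      _ = ∑ a, ∑ j, ∑ i, ∑ c, gi j c * (Γ i a c * Γ a i j) :=
          Finset.sum_congr rfl fun a _ => Finset.sum_comm
      _ = _ := by
          refine Finset.sum_congr rfl fun i _ => Finset.sum_congr rfl fun j _ =>
            Finset.sum_congr rfl fun a _ => Finset.sum_congr rfl fun b _ => ?_
          rw [hΓ i a j]; ring
  rw [hL, hR, e1, e2, e3, e4, e5, e6, e7]
  ring

end DivergenceAlgebra

/-! ### The Jacobian and positivity of the inverse metric. -/

section Jacobian

variable {n m : ℕ} {f : E n → E m} {U : Set (E n)} {x : E n}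

theorem jac_sq (f : E n → E m) (x : E n) : jac f x ^ 2 = (metric f x).det := by
  have h := (fderiv ℝ f x).toLinearMap.normDet_sq_eq_det_gram (EuclideanSpace.basisFun (Fin n) ℝ)
  simp only [RCLike.ofReal_real_eq_id, id] at h
  rw [jac, h]
  congr 1
  ext i j
  simp [Matrix.gram, metric, pd, cvec]

theorem jac_nonneg (f : E n → E m) (x : E n) : 0 ≤ jac f x :=
  LinearMap.normDet_nonneg _

theorem jac_eq_sqrt (f : E n → E m) (x : E n) : jac f x = √(metric f x).det := by
  rw [← jac_sq, Real.sqrt_sq (jac_nonneg f x)]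

namespace IsImmersionOn

variable (hf : IsImmersionOn f U) (hx : x ∈ U)
include hf

theorem contDiffOn_jac : ContDiffOn ℝ ∞ (jac f) U := by
  rw [funext (jac_eq_sqrt f)]
  exact (contDiffOn_det hf.contDiffOn_metric).sqrt hf.det_ne

include hx

theorem jac_pos : 0 < jac f x := by
  refine lt_of_le_of_ne (jac_nonneg f x) fun h => hf.det_ne x hx ?_
  rw [← jac_sq, ← h]
  simp

/-- Differentiating `J² = det g` shows that the contracted Christoffel symbol is `∂ₖ log J`; hence
`gradLog` is the gradient of `-log J`. -/
theorem pd_jac (k : Fin n) : pd k (jac f) x = jac f x * ∑ a, chr f a k a x := by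
  have hJ := hf.diffAt hx hf.contDiffOn_jac
  have h1 := hf.pd_det_metric hx k
  have h2 : (fun y => (metric f y).det) = fun y => jac f y * jac f y := by
    funext y
    rw [← jac_sq, sq]
  rw [h2, pd_mul hJ hJ, ← jac_sq] at h1
  have h3 : 2 * jac f x ≠ 0 := by
    have := (hf.jac_pos hx).ne'
    positivity
  apply mul_left_cancel₀ h3
  linear_combination h1

theorem inner_dualVec_dualVec (a b : Fin n) :
    inner ℝ (dualVec f a x) (dualVec f b x) = (metric f x)⁻¹ a b := by
  rw [inner_dualVec_eq]
  simp [hf.inner_dualVec_pd hx, metric_inv_comm f x b a]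

/-- The form is the squared norm of the tangent vector `∑ cᵢ dualVecᵢ`, because `g⁻¹` is the Gram
matrix of the dual vectors. -/
theorem metric_inv_nonneg (c : Fin n → ℝ) :
    0 ≤ ∑ i, ∑ j, (metric f x)⁻¹ i j * (c i * c j) := by
  have h : ∑ i, ∑ j, (metric f x)⁻¹ i j * (c i * c j) =
      inner ℝ (∑ i, c i • dualVec f i x) (∑ j, c j • dualVec f j x) := by
    simp only [sum_inner, inner_sum, real_inner_smul_left, real_inner_smul_right,
      hf.inner_dualVec_dualVec hx]
    rw [Finset.sum_comm]
    refine Finset.sum_congr rfl fun i _ => Finset.sum_congr rfl fun j _ => ?_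
    rw [metric_inv_comm]
    ring
  rw [h]
  exact real_inner_self_nonneg

end IsImmersionOn

end Jacobian

/-! ### Frame-free expressions for `H`, `|A|²`, `|∇h|²` and the trace term. -/

section Invariants

variable {n m k : ℕ}

/-- The mean curvature vector in coordinates. -/
noncomputable def mcv (f : E n → E m) (x : E n) : E m :=
  ∑ i, ∑ j, (metric f x)⁻¹ i j • sff f i j x

/-- `|A|²` in coordinates. -/
noncomputable def sqA (f : E n → E m) (x : E n) : ℝ :=
  ∑ i, ∑ j, ∑ k, ∑ l, (metric f x)⁻¹ i k * (metric f x)⁻¹ j l *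
    inner ℝ (sff f i j x) (sff f k l x)

/-- `|∇h|²` in coordinates. -/
noncomputable def sqGrad (f : E n → E m) (h : E n → ℝ) (x : E n) : ℝ :=
  ∑ i, ∑ j, (metric f x)⁻¹ i j * (pd i h x * pd j h x)

/-- The horizontal coordinate vectors of `E (n + k)`. -/
noncomputable def hvec (c : Fin n) : E (n + k) := EuclideanSpace.single (Fin.castAdd k c) 1

theorem inner_hvec (v : E (n + k)) (c : Fin n) : inner ℝ v (hvec c) = v (Fin.castAdd k c) := by
  simp [hvec, EuclideanSpace.inner_single_right]

/-- The trace of `u ↦ (∇^⊥_u H)` followed by the projection to the base. -/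
noncomputable def traceGradH (f : E n → E (n + k)) (x : E n) : ℝ :=
  ∑ a, inner ℝ (nproj f x (pd a (mcv f) x)) (hvec a)

/-- The gradient of `log (det g)^(-1/2)` in coordinates. -/
noncomputable def gradLog (f : E n → E m) (i : Fin n) (x : E n) : ℝ :=
  - ∑ j, ∑ a, (metric f x)⁻¹ i j * chr f a a j x

namespace IsImmersionOn

variable {f : E n → E m} {U : Set (E n)} {x : E n} (hf : IsImmersionOn f U) (hx : x ∈ U)
include hf

theorem contDiffOn_mcv : ContDiffOn ℝ ∞ (mcv f) U :=
  ContDiffOn.sum fun i _ => ContDiffOn.sum fun j _ =>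
    (hf.contDiffOn_metric_inv i j).smul (hf.contDiffOn_sff i j)

theorem contDiffOn_gradLog (i : Fin n) : ContDiffOn ℝ ∞ (gradLog f i) U :=
  (ContDiffOn.sum fun j _ => ContDiffOn.sum fun a _ =>
    (hf.contDiffOn_metric_inv i j).mul (hf.contDiffOn_chr a a j)).neg

theorem contDiffOn_sqA : ContDiffOn ℝ ∞ (sqA f) U :=
  ContDiffOn.sum fun i _ => ContDiffOn.sum fun j _ => ContDiffOn.sum fun k _ =>
    ContDiffOn.sum fun l _ => ((hf.contDiffOn_metric_inv i k).mul
      (hf.contDiffOn_metric_inv j l)).mul ((hf.contDiffOn_sff i j).inner ℝ (hf.contDiffOn_sff k l))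

theorem contDiffOn_sqGrad {h : E n → ℝ} (hh : ContDiffOn ℝ ∞ h U) :
    ContDiffOn ℝ ∞ (sqGrad f h) U :=
  ContDiffOn.sum fun i _ => ContDiffOn.sum fun j _ => (hf.contDiffOn_metric_inv i j).mul
    ((FlatGraph.contDiffOn_pd hh hf.isOpen i).mul (FlatGraph.contDiffOn_pd hh hf.isOpen j))

omit hf in
theorem contDiffOn_traceGradH {f : E n → E (n + k)} (hf : IsImmersionOn f U) :
    ContDiffOn ℝ ∞ (traceGradH f) U :=
  ContDiffOn.sum fun a _ => (hf.contDiffOn_nproj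
    (FlatGraph.contDiffOn_pd hf.contDiffOn_mcv hf.isOpen a)).inner ℝ contDiffOn_const

include hx

theorem inner_mcv_pd (b : Fin n) : inner ℝ (mcv f x) (pd b f x) = 0 := by
  simp [mcv, sum_inner, real_inner_smul_left, hf.inner_sff_pd hx]

theorem inner_pd_mcv_dualVec (a : Fin n) : inner ℝ (pd a (mcv f) x) (dualVec f a x) =
    - ∑ b, (metric f x)⁻¹ a b * inner ℝ (mcv f x) (sff f a b x) := by
  rw [inner_dualVec_eq, ← Finset.sum_neg_distrib]
  refine Finset.sum_congr rfl fun b _ => ?_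
  have h0 : EqOn (fun y => inner ℝ (mcv f y) (pd b f y)) (fun _ => (0 : ℝ)) U := fun y hy =>
    hf.inner_mcv_pd hy b
  have h1 := pd_congr hf.isOpen hx h0 a
  rw [pd_const, pd_inner (hf.diffAt hx hf.contDiffOn_mcv)
    (hf.diffAt hx (hf.contDiffOn_pd b)), real_inner_comm,
    inner_pd_pd_of_normal (hf.inner_mcv_pd hx), real_inner_comm] at h1
  linear_combination (metric f x)⁻¹ a b * h1

omit hf hx in
theorem sum_inner_mcv_sff : ∑ a, ∑ b, (metric f x)⁻¹ a b * inner ℝ (mcv f x) (sff f a b x) =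
    ∑ i, ∑ j, ∑ k, ∑ l, (metric f x)⁻¹ i j * (metric f x)⁻¹ k l *
      inner ℝ (sff f i j x) (sff f k l x) := by
  have h : ∑ a, ∑ b, (metric f x)⁻¹ a b * inner ℝ (mcv f x) (sff f a b x) =
      inner ℝ (mcv f x) (mcv f x) := by
    conv_rhs => enter [3]; rw [mcv]
    simp only [inner_sum, real_inner_smul_right]
  rw [h, mcv]
  simp only [sum_inner, inner_sum, real_inner_smul_left, real_inner_smul_right, mul_assoc]
  simp only [real_inner_comm]

theorem sum_pd_gradLog :
    ∑ i, pd i (gradLog f i) x = - ∑ i, ∑ j, ∑ a, ((metric f x)⁻¹ i j * pd i (chr f a a j) x +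
      pd i (fun y => (metric f y)⁻¹ i j) x * chr f a a j x) := by
  rw [← Finset.sum_neg_distrib]
  refine Finset.sum_congr rfl fun i _ => ?_
  have hd : ∀ j a, DifferentiableAt ℝ (fun y => (metric f y)⁻¹ i j * chr f a a j y) x :=
    fun j a => (hf.diffAt hx (hf.contDiffOn_metric_inv i j)).fun_mul
      (hf.diffAt hx (hf.contDiffOn_chr a a j))
  change pd i (fun y => - ∑ j, ∑ a, (metric f y)⁻¹ i j * chr f a a j y) x = _
  rw [pd_neg, pd_sum fun j _ => DifferentiableAt.fun_sum fun a _ => hd j a]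
  congr 1
  refine Finset.sum_congr rfl fun j _ => ?_
  rw [pd_sum fun a _ => hd j a]
  refine Finset.sum_congr rfl fun a _ => ?_
  exact pd_mul (hf.diffAt hx (hf.contDiffOn_metric_inv i j))
    (hf.diffAt hx (hf.contDiffOn_chr a a j)) i

end IsImmersionOn

end Invariants

/-! ### Graphs: Christoffel symbols as horizontal components of `A`. -/

section HorizontalImmersions

variable {n k : ℕ}

/-- `f` is a smooth immersion whose first `n` components are the coordinates. -/
structure IsGraphOn (f : E n → E (n + k)) (U : Set (E n)) : Prop extends IsImmersionOn f U where
  apply_castAdd : ∀ x c, f x (Fin.castAdd k c) = x c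

namespace IsGraphOn

variable {f : E n → E (n + k)} {U : Set (E n)} {x : E n} (hf : IsGraphOn f U) (hx : x ∈ U)
include hf hx

theorem inner_pd_hvec (a c : Fin n) : inner ℝ (pd a f x) (hvec c) = if a = c then 1 else 0 := by
  have h1 : EqOn (fun y => inner ℝ (f y) (hvec c)) (fun y => y c) U := fun y _ => by
    simp only [inner_hvec, hf.apply_castAdd]
  have h2 := pd_congr hf.isOpen hx h1 a
  rw [pd_inner (hf.diffAt hx hf.smooth) (differentiableAt_const _), pd_const, inner_zero_right,
    zero_add] at h2
  rw [h2]
  have h3 : pd a (fun y : E n => y c) x = cvec a c := by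
    change fderiv ℝ (EuclideanSpace.proj c : E n →L[ℝ] ℝ) x (cvec a) = _
    rw [ContinuousLinearMap.fderiv]
    rfl
  rw [h3]
  simp [cvec, eq_comm]

theorem inner_fderiv_hvec (u : E n) (c : Fin n) : inner ℝ (fderiv ℝ f x u) (hvec c) = u c := by
  rw [fderiv_apply_eq_sum]
  simp [sum_inner, real_inner_smul_left, hf.inner_pd_hvec hx]

theorem inner_pd_pd_hvec (i j c : Fin n) : inner ℝ (pd i (pd j f) x) (hvec c) = 0 := by
  have h1 : EqOn (fun y => inner ℝ (pd j f y) (hvec c)) (fun _ => if j = c then (1 : ℝ) else 0) U :=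
    fun y hy => hf.inner_pd_hvec hy j c
  have h2 := pd_congr hf.isOpen hx h1 i
  rwa [pd_inner (hf.diffAt hx (hf.contDiffOn_pd j)) (differentiableAt_const _), pd_const, pd_const,
    inner_zero_right, zero_add] at h2

theorem inner_nproj_hvec (v : E (n + k)) (c : Fin n) :
    inner ℝ (nproj f x v) (hvec c) = inner ℝ v (hvec c) - inner ℝ v (dualVec f c x) := by
  simp [nproj, inner_sub_left, sum_inner, real_inner_smul_left, hf.inner_pd_hvec hx]

/-- As `∂ᵢ∂ⱼf` is vertical, the horizontal components of its normal and tangential parts are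
opposite. This turns statements about `A`, such as the Ricci equation, into statements about `Γ`. -/
theorem inner_sff_hvec (i j c : Fin n) : inner ℝ (sff f i j x) (hvec c) = - chr f c i j x := by
  rw [sff, hf.inner_nproj_hvec hx, hf.inner_pd_pd_hvec hx, chr, zero_sub]

/-- The horizontal components of `H` are `-gᵃᵇ Γⁱ_ab`, whose divergence gives the last sum. Removing
the tangential part of `∂ᵢH` adds `|H|²` by the Weingarten relation, which is the first sum. -/
theorem traceGradH_eq : traceGradH f x =
    (∑ i, ∑ j, ∑ k, ∑ l, (metric f x)⁻¹ i j * (metric f x)⁻¹ k l *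
      inner ℝ (sff f i j x) (sff f k l x))
    - ∑ i, ∑ a, ∑ b, ((metric f x)⁻¹ a b * pd i (chr f i a b) x +
      pd i (fun y => (metric f y)⁻¹ a b) x * chr f i a b x) := by
  rw [← IsImmersionOn.sum_inner_mcv_sff, ← Finset.sum_sub_distrib]
  refine Finset.sum_congr rfl fun i _ => ?_
  rw [hf.inner_nproj_hvec hx, hf.inner_pd_mcv_dualVec hx, sub_neg_eq_add, add_comm, sub_eq_add_neg]
  congr 1
  have hd : ∀ a b, DifferentiableAt ℝ (fun y => (metric f y)⁻¹ a b * chr f i a b y) x :=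
    fun a b => (hf.diffAt hx (hf.contDiffOn_metric_inv a b)).fun_mul
      (hf.diffAt hx (hf.contDiffOn_chr i a b))
  have h1 : EqOn (fun y => inner ℝ (mcv f y) (hvec i))
      (fun y => - ∑ a, ∑ b, (metric f y)⁻¹ a b * chr f i a b y) U := fun y hy => by
    simp [mcv, sum_inner, real_inner_smul_left, hf.inner_sff_hvec hy]
  have h2 := pd_congr hf.isOpen hx h1 i
  rw [pd_inner (hf.diffAt hx hf.contDiffOn_mcv) (differentiableAt_const _), pd_const,
    inner_zero_right, zero_add, pd_neg,
    pd_sum fun a _ => DifferentiableAt.fun_sum fun b _ => hd a b] at h2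
  rw [h2]
  congr 1
  refine Finset.sum_congr rfl fun a _ => ?_
  rw [pd_sum fun b _ => hd a b]
  refine Finset.sum_congr rfl fun b _ => ?_
  exact pd_mul (hf.diffAt hx (hf.contDiffOn_metric_inv a b))
    (hf.diffAt hx (hf.contDiffOn_chr i a b)) i

/-- The formula for `Δ log *Ω` of a graph with flat normal bundle, in divergence form. -/
theorem sum_pd_gradLog_eq (hflat : FlatNormalBundle f U) :
    ∑ i, pd i (gradLog f i) x = traceGradH f x - sqA f x := by
  rw [hf.sum_pd_gradLog hx, hf.traceGradH_eq hx, sqA, sub_right_comm]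
  refine divergence_identity (gi := fun a b => (metric f x)⁻¹ a b)
    (Γ := fun c i j => chr f c i j x)
    (S := fun i j k l => inner ℝ (sff f i j x) (sff f k l x))
    (T := fun k i j a => inner ℝ (pd k (pd i (pd j f)) x) (dualVec f a x))
    (dΓ := fun k a i j => pd k (chr f a i j) x)
    (dgi := fun k a b => pd k (fun y => (metric f y)⁻¹ a b) x)
    (metric_inv_comm f x) (hf.chr_comm hx)
    (fun i j k l => by rw [hf.sff_comm hx k l]) (fun k i j a => ?_)
    (hf.pd_metric_inv hx) (hf.pd_chr hx) (fun i j p q => ?_)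
  · rw [pd_comm (hf.contDiffOn_pd j) hf.isOpen hx]
  -- The Ricci equation on two horizontal vectors; the two minus signs cancel.
  · simpa [hf.inner_sff_hvec hx] using
      hf.sum_sff_mul_sff_comm hx hflat i j (hvec p) (hvec q)

end IsGraphOn

theorem isGraphOn_graphMap {U : Set (E n)} (hU : IsOpen U) {ψ : E n → E k}
    (hψ : ContDiffOn ℝ ∞ ψ U) : IsGraphOn (graphMap ψ) U := by
  have hsmooth : ContDiffOn ℝ ∞ (graphMap ψ) U := by
    refine contDiffOn_euclidean.2 fun i => ?_
    refine Fin.addCases (fun a => ?_) (fun b => ?_) i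
    · simp only [graphMap, Fin.append_left]
      exact contDiffOn_euclidean.1 contDiffOn_id a
    · simp only [graphMap, Fin.append_right]
      exact contDiffOn_euclidean.1 hψ b
  have happ : ∀ x c, graphMap ψ x (Fin.castAdd k c) = x c := fun x c => by
    simp [graphMap]
  refine ⟨⟨hU, hsmooth, fun x hx h0 => ?_⟩, happ⟩
  rw [← jac_sq, sq_eq_zero_iff, jac] at h0
  refine absurd ?_ (((LinearMap.normDet_eq_zero_tfae _).out 0 5).1 h0)
  intro u v huv
  have hd := ContDiffOn.differentiableAt_of_isOpen hsmooth hU hx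
  -- The horizontal components of `df(u)` recover `u`, so the differential is injective and its
  -- Jacobian cannot vanish.
  have hval : ∀ (u : E n) c, fderiv ℝ (graphMap ψ) x u (Fin.castAdd k c) = u c := by
    intro u c
    have h1 : HasFDerivAt (fun y => graphMap ψ y (Fin.castAdd k c))
        ((EuclideanSpace.proj (Fin.castAdd k c) : E (n + k) →L[ℝ] ℝ).comp
          (fderiv ℝ (graphMap ψ) x)) x :=
      (EuclideanSpace.proj (Fin.castAdd k c) : E (n + k) →L[ℝ] ℝ).hasFDerivAt.comp x
        hd.hasFDerivAt
    have h2 : HasFDerivAt (fun y : E n => y c) (EuclideanSpace.proj c : E n →L[ℝ] ℝ) x :=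
      (EuclideanSpace.proj c : E n →L[ℝ] ℝ).hasFDerivAt
    simp only [happ] at h1
    exact congrArg (fun L : E n →L[ℝ] ℝ => L u) (h1.unique h2)
  ext c
  rw [← hval u, ← hval v]
  exact congrArg (fun w : E (n + k) => w (Fin.castAdd k c)) huv

theorem IsGraphOn.norm_le_norm_fderiv {f : E n → E (n + k)} {U : Set (E n)} {x : E n}
    (hf : IsGraphOn f U) (hx : x ∈ U) (u : E n) : ‖u‖ ≤ ‖fderiv ℝ f x u‖ := by
  refine le_of_sq_le_sq ?_ (norm_nonneg _)
  rw [EuclideanSpace.norm_sq_eq, EuclideanSpace.norm_sq_eq, Fin.sum_univ_add]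
  have : ∀ i, u i = fderiv ℝ f x u (Fin.castAdd k i) := fun i => by
    rw [← inner_hvec, hf.inner_fderiv_hvec hx]
  simp only [← this]
  exact le_add_of_nonneg_right (Finset.sum_nonneg fun _ _ => sq_nonneg _)

end HorizontalImmersions

/-! ### From tangent frames to contractions with the inverse metric. -/

section Frames

variable {n m k : ℕ} {x : E n}

theorem inducedMetric_eq (f : E n → E m) (x u v : E n) :
    inducedMetric f x u v = ∑ i, ∑ j, u i * (metric f x i j * v j) := by
  simp only [inducedMetric, fderiv_apply_eq_sum, sum_inner, inner_sum, real_inner_smul_left,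
    real_inner_smul_right, metric, Matrix.of_apply]
  rw [Finset.sum_comm]
  exact Finset.sum_congr rfl fun i _ => Finset.sum_congr rfl fun j _ => by ring

/-- The matrix whose columns are the coordinates of the vectors of a frame. -/
def frameMatrix (e : Fin n → E n) : Matrix (Fin n) (Fin n) ℝ := Matrix.of fun i a => e a i

/-- Orthonormality reads `Fᵀ g F = 1`, and one-sided inverses of square matrices are two-sided.
Consequently every sum over the frame is a contraction with `g⁻¹`. -/
theorem frameMatrix_mul_transpose {f : E n → E m} {e : Fin n → E n}
    (he : ∀ i j, inducedMetric f x (e i) (e j) = if i = j then 1 else 0) :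
    frameMatrix e * (frameMatrix e).transpose = (metric f x)⁻¹ := by
  have h1 : (frameMatrix e).transpose * (metric f x * frameMatrix e) = 1 := by
    ext a b
    rw [Matrix.one_apply, ← he a b, inducedMetric_eq, Matrix.mul_apply]
    refine Finset.sum_congr rfl fun i _ => ?_
    rw [Matrix.mul_apply, Finset.mul_sum]
    rfl
  rw [← Matrix.mul_assoc, mul_eq_one_comm, ← Matrix.mul_assoc] at h1
  exact (Matrix.inv_eq_left_inv h1).symm

theorem isUnit_det_frameMatrix {f : E n → E m} {e : Fin n → E n}
    (he : ∀ i j, inducedMetric f x (e i) (e j) = if i = j then 1 else 0)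
    (hdet : (metric f x).det ≠ 0) : IsUnit (frameMatrix e).det := by
  have h := congrArg Matrix.det (frameMatrix_mul_transpose he)
  rw [Matrix.det_mul, Matrix.det_transpose] at h
  refine Ne.isUnit fun h0 => ?_
  rw [h0, mul_zero, Matrix.det_nonsing_inv, Ring.inverse_eq_inv'] at h
  exact inv_ne_zero hdet h.symm

theorem sum_frame_smul {M : Type*} [AddCommGroup M] [Module ℝ M] {f : E n → E m}
    {e : Fin n → E n} (he : ∀ i j, inducedMetric f x (e i) (e j) = if i = j then 1 else 0)
    (c : Fin n → Fin n → M) :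
    ∑ p, ∑ i, ∑ j, (e p i * e p j) • c i j = ∑ i, ∑ j, (metric f x)⁻¹ i j • c i j := by
  rw [Finset.sum_comm]
  refine Finset.sum_congr rfl fun i _ => ?_
  rw [Finset.sum_comm]
  refine Finset.sum_congr rfl fun j _ => ?_
  rw [← Finset.sum_smul, ← frameMatrix_mul_transpose he]
  rfl

theorem sum_frame_mul {f : E n → E m}
    {e : Fin n → E n} (he : ∀ i j, inducedMetric f x (e i) (e j) = if i = j then 1 else 0)
    (c : Fin n → Fin n → ℝ) :
    ∑ p, ∑ i, ∑ j, (e p i * e p j) * c i j = ∑ i, ∑ j, (metric f x)⁻¹ i j * c i j :=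
  sum_frame_smul he c

theorem sum_frame_norm_sq {f : E n → E m}
    {e : Fin n → E n} (he : ∀ i j, inducedMetric f x (e i) (e j) = if i = j then 1 else 0)
    (B : Fin n → E m) : ∑ p, ‖∑ i, e p i • B i‖ ^ 2 =
      ∑ i, ∑ j, (metric f x)⁻¹ i j * inner ℝ (B i) (B j) := by
  rw [← sum_frame_mul he]
  refine Finset.sum_congr rfl fun p _ => ?_
  rw [← real_inner_self_eq_norm_sq]
  simp only [sum_inner, inner_sum, real_inner_smul_left, real_inner_smul_right]
  exact Finset.sum_congr rfl fun i _ => Finset.sum_congr rfl fun j _ => by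
    rw [real_inner_comm]; ring

theorem normSqGrad_eq {f : E n → E m} {e : E n → Fin n → E n}
    (he : ∀ i j, inducedMetric f x (e x i) (e x j) = if i = j then 1 else 0) (φ : E m → ℝ) :
    normSqGrad f e φ x = sqGrad f (fun y => φ (f y)) x := by
  rw [sqGrad, ← sum_frame_mul he, normSqGrad]
  refine Finset.sum_congr rfl fun p _ => ?_
  rw [fderiv_apply_eq_sum, sq, Finset.sum_mul_sum]
  exact Finset.sum_congr rfl fun i _ => Finset.sum_congr rfl fun j _ => by
    simp only [smul_eq_mul]; ring

variable {f : E n → E m} {U : Set (E n)}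

theorem IsImmersionOn.meanCurvature_eq (hf : IsImmersionOn f U) (hx : x ∈ U)
    {e : E n → Fin n → E n} (he : IsTangentFrame f U e) : meanCurvature f e x = mcv f x := by
  rw [mcv, ← sum_frame_smul (he x hx), meanCurvature]
  exact Finset.sum_congr rfl fun p _ => hf.secondFundamentalForm_eq hx _ _

theorem IsImmersionOn.normSqA_eq (hf : IsImmersionOn f U) (hx : x ∈ U)
    {e : E n → Fin n → E n} (he : IsTangentFrame f U e) : normSqA f e x = sqA f x := by
  have h1 : ∀ p q, secondFundamentalForm f x (e x p) (e x q) =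
      ∑ j, e x q j • ∑ i, e x p i • sff f i j x := fun p q => by
    rw [hf.secondFundamentalForm_eq hx, Finset.sum_comm]
    simp only [Finset.smul_sum, smul_smul, mul_comm]
  simp only [normSqA, h1, sum_frame_norm_sq (he x hx)]
  rw [Finset.sum_comm]
  calc ∑ j, ∑ p, ∑ l, (metric f x)⁻¹ j l *
        inner ℝ (∑ i, e x p i • sff f i j x) (∑ i, e x p i • sff f i l x)
      = ∑ j, ∑ l, (metric f x)⁻¹ j l *
          ∑ p, ∑ i, ∑ k, (e x p i * e x p k) * inner ℝ (sff f i j x) (sff f k l x) := by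
        refine Finset.sum_congr rfl fun j _ => ?_
        rw [Finset.sum_comm]
        refine Finset.sum_congr rfl fun l _ => ?_
        rw [Finset.mul_sum]
        refine Finset.sum_congr rfl fun p _ => ?_
        simp only [sum_inner, inner_sum, real_inner_smul_left, real_inner_smul_right]
        rw [Finset.sum_comm]
        simp only [mul_assoc, mul_left_comm]
    _ = ∑ j, ∑ l, ∑ i, ∑ k, (metric f x)⁻¹ i k * (metric f x)⁻¹ j l *
          inner ℝ (sff f i j x) (sff f k l x) := by
        refine Finset.sum_congr rfl fun j _ => Finset.sum_congr rfl fun l _ => ?_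
        rw [sum_frame_mul (he x hx), Finset.mul_sum]
        refine Finset.sum_congr rfl fun i _ => ?_
        rw [Finset.mul_sum]
        exact Finset.sum_congr rfl fun k _ => by ring
    _ = ∑ j, ∑ i, ∑ l, ∑ k, (metric f x)⁻¹ i k * (metric f x)⁻¹ j l *
          inner ℝ (sff f i j x) (sff f k l x) :=
        Finset.sum_congr rfl fun j _ => Finset.sum_comm
    _ = ∑ i, ∑ j, ∑ l, ∑ k, (metric f x)⁻¹ i k * (metric f x)⁻¹ j l *
          inner ℝ (sff f i j x) (sff f k l x) := Finset.sum_comm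
    _ = sqA f x :=
        Finset.sum_congr rfl fun i _ => Finset.sum_congr rfl fun j _ => Finset.sum_comm

end Frames

/-! ### Normal frames and the trace form of the `K₁` term. -/

section NormalFrames

variable {n k : ℕ} {x : E n} {f : E n → E (n + k)} {U : Set (E n)}

theorem IsImmersionOn.finrank_normalSpace (hf : IsImmersionOn f U) (hx : x ∈ U) :
    Module.finrank ℝ (normalSpace f x) = k := by
  have hinj : Module.finrank ℝ (tangentSpace f x) = n := by
    have h0 : (fderiv ℝ f x).toLinearMap.normDet ≠ 0 := (hf.jac_pos hx).ne'
    have := ((LinearMap.normDet_ne_zero_tfae _).out 0 2).1 h0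
    exact this.trans finrank_euclideanSpace_fin
  have := Submodule.finrank_add_finrank_orthogonal (tangentSpace f x)
  rw [hinj, finrank_euclideanSpace_fin] at this
  exact Nat.add_left_cancel this

/-- The `k` orthonormal vectors span the normal space because its dimension is `k`. -/
theorem IsImmersionOn.sum_inner_smul_normalFrame (hf : IsImmersionOn f U) (hx : x ∈ U)
    {ν : Fin k → E (n + k)} (hmem : ∀ a, ν a ∈ normalSpace f x) (hν : Orthonormal ℝ ν)
    {v : E (n + k)} (hv : v ∈ normalSpace f x) : ∑ a, inner ℝ v (ν a) • ν a = v := by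
  have hle : Submodule.span ℝ (range ν) ≤ normalSpace f x :=
    Submodule.span_le.2 (range_subset_iff.2 hmem)
  have heq : Submodule.span ℝ (range ν) = normalSpace f x := by
    refine Submodule.eq_of_le_of_finrank_eq hle ?_
    rw [hf.finrank_normalSpace hx, finrank_span_eq_card hν.linearIndependent, Fintype.card_fin]
  rw [← heq] at hv
  obtain ⟨c, rfl⟩ := (Submodule.mem_span_range_iff_exists_fun ℝ).1 hv
  refine Finset.sum_congr rfl fun a _ => ?_
  rw [hν.inner_left_fintype]
  simp

theorem IsGraphOn.w_eq (hf : IsGraphOn f U) (hx : x ∈ U) (e : E n → Fin n → E n) :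
    w f e x = (frameMatrix (e x)).det := by
  rw [w, parallelForm]
  congr 1
  ext i j
  rw [Matrix.of_apply, ← inner_hvec, hf.inner_fderiv_hvec hx]
  rfl

theorem IsGraphOn.formCoeff_eq (hf : IsGraphOn f U) (hx : x ∈ U) (e : E n → Fin n → E n)
    (ν : E n → Fin k → E (n + k)) (a : Fin k) (i : Fin n) :
    formCoeff f e ν x a i =
      (frameMatrix (e x)).cramer (fun j => ν x a (Fin.castAdd k j)) i := by
  rw [formCoeff, parallelForm, Matrix.cramer_apply]
  congr 1
  ext j l
  rw [Matrix.of_apply, Matrix.updateCol_apply, Function.update_apply]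
  split_ifs with h
  · rfl
  · rw [← inner_hvec, hf.inner_fderiv_hvec hx]
    rfl

/-- The term `w⁻¹ ∑ Ω_{αi} ∇ᵢ H_α` is a trace, and so does not depend on the frames. -/
theorem IsGraphOn.inv_w_mul_sum_eq (hf : IsGraphOn f U) (hx : x ∈ U) {e : E n → Fin n → E n}
    (he : IsTangentFrame f U e) {ν : E n → Fin k → E (n + k)} (hν : IsNormalFrame f U ν) :
    (w f e x)⁻¹ * ∑ a, ∑ i, formCoeff f e ν x a i * gradH f e ν x a i = traceGradH f x := by
  -- By Cramer's rule, `w⁻¹ Ω_{αi}` is the `i`-th entry of `F⁻¹` applied to the horizontal part of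
  -- `e_α`. Summing over `α` reassembles `∇^⊥_{eᵢ} H`, and summing over `i` gives the trace of a
  -- conjugate by `F`, hence a trace without `F`.
  set F := frameMatrix (e x) with hF
  have hFdet : IsUnit F.det := isUnit_det_frameMatrix (he x hx) (hf.det_ne x hx)
  set N : Fin n → E (n + k) := fun l => nproj f x (pd l (mcv f) x) with hN
  set z : Fin n → E (n + k) := fun i => normalDeriv f (meanCurvature f e) x (e x i) with hz
  have hzN : ∀ i, z i = ∑ l, e x i l • N l := fun i => by
    -- The frame `e` need not be continuous; `H` is differentiated through its frame-free form,
    -- which agrees with it near `x`.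
    have h1 : meanCurvature f e =ᶠ[𝓝 x] mcv f := by
      filter_upwards [hf.isOpen.mem_nhds hx] with y hy using hf.meanCurvature_eq hy he
    simp only [hz, hN, normalDeriv, h1.fderiv_eq, fderiv_apply_eq_sum, ← hf.normalProj_eq hx,
      map_sum, map_smul]
  have hzn : ∀ i, z i ∈ normalSpace f x := fun i => by
    simp only [hz, normalDeriv, hf.normalProj_eq hx]
    exact IsImmersionOn.mem_normalSpace_iff.2 (hf.inner_nproj_pd hx _)
  have hsum : ∀ i, ∑ a, formCoeff f e ν x a i * gradH f e ν x a i =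
      F.cramer (fun j => z i (Fin.castAdd k j)) i := fun i => by
    have h1 : (fun j => z i (Fin.castAdd k j)) =
        ∑ a, inner ℝ (z i) (ν x a) • fun j => ν x a (Fin.castAdd k j) := by
      funext j
      conv_lhs => rw [← hf.sum_inner_smul_normalFrame hx (hν x hx).1 (hν x hx).2 (hzn i)]
      simp
    rw [h1, map_sum, Finset.sum_apply]
    refine Finset.sum_congr rfl fun a _ => ?_
    rw [hf.formCoeff_eq hx, map_smul, Pi.smul_apply, smul_eq_mul, mul_comm]
    rfl
  have hcr : ∀ i, (w f e x)⁻¹ * F.cramer (fun j => z i (Fin.castAdd k j)) i =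
      ∑ j, F⁻¹ i j * z i (Fin.castAdd k j) := fun i => by
    rw [hf.w_eq hx, Matrix.cramer_eq_adjugate_mulVec, Matrix.mulVec, dotProduct, Finset.mul_sum]
    simp only [Matrix.inv_def, Ring.inverse_eq_inv', Matrix.smul_apply, smul_eq_mul, mul_assoc,
      ← hF]
  rw [Finset.sum_comm, Finset.mul_sum]
  simp only [hsum, hcr]
  have hzl : ∀ i j, z i (Fin.castAdd k j) = ∑ l, F l i * N l (Fin.castAdd k j) := fun i j => by
    rw [hzN]
    simp [hF, frameMatrix]
  have hFF := Matrix.mul_nonsing_inv F hFdet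
  calc ∑ i, ∑ j, F⁻¹ i j * z i (Fin.castAdd k j)
      = ∑ j, ∑ i, ∑ l, F l i * F⁻¹ i j * N l (Fin.castAdd k j) := by
        rw [Finset.sum_comm]
        refine Finset.sum_congr rfl fun j _ => Finset.sum_congr rfl fun i _ => ?_
        rw [hzl, Finset.mul_sum]
        exact Finset.sum_congr rfl fun l _ => by ring
    _ = ∑ j, ∑ l, (F * F⁻¹) l j * N l (Fin.castAdd k j) := by
        refine Finset.sum_congr rfl fun j _ => ?_
        rw [Finset.sum_comm]
        refine Finset.sum_congr rfl fun l _ => ?_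
        rw [← Finset.sum_mul, Matrix.mul_apply]
    _ = ∑ j, N j (Fin.castAdd k j) := by
        simp [hFF, Matrix.one_apply]
    _ = traceGradH f x := by
        simp only [traceGradH, inner_hvec, hN]

end NormalFrames

/-! ### The pointwise stability inequality. -/

section Stability

variable {n k : ℕ} {x : E n} {f : E n → E (n + k)} {U : Set (E n)}

theorem contDiffOn_flux {n m : ℕ} {f : E n → E m} {U : Set (E n)} (hf : IsImmersionOn f U)
    {h : E n → ℝ} (hh : ContDiffOn ℝ ∞ h U) (i : Fin n) :
    ContDiffOn ℝ ∞ (fun y => h y ^ 2 * jac f y * gradLog f i y) U :=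
  ((hh.pow 2).mul hf.contDiffOn_jac).mul (hf.contDiffOn_gradLog i)

/-- The right side minus the left is `J |∇h + h ∇ log J|²` plus `J h²` times the negative part of
the trace term, and both are nonnegative. The subtracted divergence integrates to zero. -/
theorem IsGraphOn.jac_mul_sqA_le (hf : IsGraphOn f U) (hx : x ∈ U)
    (hflat : FlatNormalBundle f U) {h : E n → ℝ} (hh : ContDiffOn ℝ ∞ h U) :
    jac f x * (sqA f x * h x ^ 2) ≤
      jac f x * (sqGrad f h x + max (traceGradH f x) 0 * h x ^ 2)
        - ∑ i, pd i (fun y => h y ^ 2 * jac f y * gradLog f i y) x := by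
  have hJ := hf.jac_pos hx
  set u : Fin n → ℝ := fun i => ∑ a, chr f a i a x with hu
  have hdh := hf.diffAt hx hh
  have hdJ := hf.diffAt hx hf.contDiffOn_jac
  have hdiv : ∀ i, pd i (fun y => h y ^ 2 * jac f y * gradLog f i y) x =
      h x ^ 2 * jac f x * pd i (gradLog f i) x +
        jac f x * ((2 * h x * pd i h x + h x ^ 2 * u i) * gradLog f i x) := fun i => by
    have h2 : pd i (fun y => h y ^ 2) x = 2 * h x * pd i h x := by
      simp only [sq]
      rw [pd_mul hdh hdh]
      ring
    rw [pd_mul ((hdh.fun_pow 2).fun_mul hdJ) (hf.diffAt hx (hf.contDiffOn_gradLog i)),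
      pd_mul (hdh.fun_pow 2) hdJ, h2, hf.pd_jac hx]
    ring
  have hgl : ∀ i, gradLog f i x = - ∑ j, (metric f x)⁻¹ i j * u j := fun i => by
    rw [gradLog]
    congr 1
    refine Finset.sum_congr rfl fun j _ => ?_
    rw [hu, Finset.mul_sum]
    exact Finset.sum_congr rfl fun a _ => by rw [hf.chr_comm hx]
  have hpsd := hf.metric_inv_nonneg hx fun i => pd i h x + h x * u i
  have hexp : ∑ i, ∑ j, (metric f x)⁻¹ i j * ((pd i h x + h x * u i) * (pd j h x + h x * u j)) =
      sqGrad f h x - ∑ i, (2 * h x * pd i h x + h x ^ 2 * u i) * gradLog f i x := by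
    have hsw : ∑ i, ∑ j, (metric f x)⁻¹ i j * (h x * u i * pd j h x) =
        ∑ i, ∑ j, (metric f x)⁻¹ i j * (h x * pd i h x * u j) := by
      rw [Finset.sum_comm]
      refine Finset.sum_congr rfl fun i _ => Finset.sum_congr rfl fun j _ => ?_
      rw [metric_inv_comm]
      ring
    calc _ = sqGrad f h x + (∑ i, ∑ j, (metric f x)⁻¹ i j * (h x * pd i h x * u j))
          + (∑ i, ∑ j, (metric f x)⁻¹ i j * (h x * u i * pd j h x))
          + ∑ i, ∑ j, (metric f x)⁻¹ i j * (h x ^ 2 * u i * u j) := by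
          simp only [sqGrad, ← Finset.sum_add_distrib]
          exact Finset.sum_congr rfl fun i _ => Finset.sum_congr rfl fun j _ => by ring
      _ = _ := by
          rw [hsw, sub_eq_add_neg, ← Finset.sum_neg_distrib, add_assoc, add_assoc]
          congr 1
          simp only [hgl, mul_neg, neg_neg, Finset.mul_sum, ← Finset.sum_add_distrib]
          exact Finset.sum_congr rfl fun i _ => Finset.sum_congr rfl fun j _ => by ring
  rw [hexp] at hpsd
  simp only [hdiv, Finset.sum_add_distrib]
  rw [← Finset.mul_sum, ← Finset.mul_sum, hf.sum_pd_gradLog_eq hx hflat]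
  have h1 : jac f x * (traceGradH f x * h x ^ 2) ≤
      jac f x * (max (traceGradH f x) 0 * h x ^ 2) :=
    mul_le_mul_of_nonneg_left (mul_le_mul_of_nonneg_right (le_max_left _ _) (sq_nonneg _)) hJ.le
  have h2 := mul_nonneg hJ.le hpsd
  linarith

end Stability

/-! ### Integration over the graph. -/

section Integration

variable {n k : ℕ} {f : E n → E (n + k)} {U : Set (E n)}

theorem continuous_base : Continuous (base : E (n + k) → E n) :=
  (PiLp.continuous_toLp 2 _).comp (continuous_pi fun i => by fun_prop)

theorem IsGraphOn.base_apply (hf : IsGraphOn f U) (x : E n) : base (f x) = x := by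
  ext c
  simp [base, hf.apply_castAdd]

theorem IsGraphOn.measurableSet_image (hf : IsGraphOn f U) : MeasurableSet (f '' U) :=
  hf.isOpen.measurableSet.image_of_continuousOn_injOn hf.smooth.continuousOn
    (Function.LeftInverse.injective hf.base_apply).injOn

theorem IsGraphOn.map_base (hf : IsGraphOn f U) :
    ((Measure.hausdorffMeasure (n : ℝ)).restrict (f '' U)).map base =
      ((Measure.hausdorffMeasure (n : ℝ)).restrict U).withDensity
        fun x => ((jac f x).toNNReal : ℝ≥0∞) :=
  map_restrict_image_hausdorffMeasure hf.isOpen continuous_base.measurable hf.base_apply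
    (fun _ hx => (hf.smooth.contDiffAt (hf.isOpen.mem_nhds hx)).hasStrictFDerivAt (by simp))
    (fun _ hx => hf.norm_le_norm_fderiv hx) hf.contDiffOn_jac.continuousOn
    (fun _ hx => hf.jac_pos hx)

/-- Integration over a graph in the base coordinates. -/
theorem IsGraphOn.integrableOn_and_integral_eq (hf : IsGraphOn f U) {K : Set (E n)}
    (hK : IsCompact K) (hKU : K ⊆ U) {g : E n → ℝ} (hg : ContinuousOn g U)
    (h0 : ∀ x ∈ U, x ∉ K → g x = 0) {G : E (n + k) → ℝ} (hG : ∀ x ∈ U, G (f x) = g x) :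
    IntegrableOn G (f '' U) (Measure.hausdorffMeasure (n : ℝ)) ∧
      ∫ p in f '' U, G p ∂Measure.hausdorffMeasure (n : ℝ) =
        ∫ x in U, jac f x * g x ∂Measure.hausdorffMeasure (n : ℝ) := by
  have hae : G =ᵐ[(Measure.hausdorffMeasure (n : ℝ)).restrict (f '' U)] g ∘ base := by
    refine ae_restrict_of_forall_mem hf.measurableSet_image ?_
    rintro _ ⟨x, hx, rfl⟩
    rw [hG x hx, Function.comp_apply, hf.base_apply]
  have hJ : AEMeasurable (fun x => (jac f x).toNNReal)
      ((Measure.hausdorffMeasure (n : ℝ)).restrict U) :=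
    (hf.contDiffOn_jac.continuousOn.aemeasurable hf.isOpen.measurableSet).real_toNNReal
  have hgm : AEStronglyMeasurable g
      (((Measure.hausdorffMeasure (n : ℝ)).restrict (f '' U)).map base) := by
    rw [hf.map_base]
    exact (hg.aestronglyMeasurable hf.isOpen.measurableSet).mono_ac
      (withDensity_absolutelyContinuous _ _)
  have hbase : AEMeasurable (base : E (n + k) → E n)
      ((Measure.hausdorffMeasure (n : ℝ)).restrict (f '' U)) := continuous_base.aemeasurable
  have hsmul : EqOn (fun x => (jac f x).toNNReal • g x) (fun x => jac f x * g x) U := fun x _ => by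
    simp [NNReal.smul_def, Real.coe_toNNReal _ (jac_nonneg f x)]
  constructor
  · rw [IntegrableOn, integrable_congr hae, ← integrable_map_measure hgm hbase, hf.map_base,
      integrable_withDensity_iff_integrable_smul₀ hJ]
    refine IntegrableOn.congr_fun ?_ hsmul.symm hf.isOpen.measurableSet
    exact integrableOn_of_continuousOn_of_eq_zero hf.isOpen hK hKU
      (hf.contDiffOn_jac.continuousOn.mul hg) (fun x hx hxK => by simp [h0 x hx hxK]) _
  · rw [integral_congr_ae hae]
    simp only [Function.comp_apply]
    rw [← integral_map hbase hgm, hf.map_base, integral_withDensity_eq_integral_smul₀ hJ]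
    exact setIntegral_congr_fun hf.isOpen.measurableSet hsmul

/-- The stability inequality of a graph with flat normal bundle, in the base coordinates. -/
theorem IsGraphOn.setIntegral_jac_mul_sqA_le (hf : IsGraphOn f U) (hflat : FlatNormalBundle f U)
    {h : E n → ℝ} (hh : ContDiffOn ℝ ∞ h U) {K : Set (E n)} (hK : IsCompact K) (hKU : K ⊆ U)
    (h0 : ∀ x ∈ U, x ∉ K → h x = 0) (h0' : ∀ x ∈ U, x ∉ K → sqGrad f h x = 0) :
    ∫ x in U, jac f x * (sqA f x * h x ^ 2) ∂Measure.hausdorffMeasure (n : ℝ) ≤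
      ∫ x in U, jac f x * (sqGrad f h x + max (traceGradH f x) 0 * h x ^ 2)
        ∂Measure.hausdorffMeasure (n : ℝ) := by
  have hJ := hf.contDiffOn_jac.continuousOn
  have hh2 := (hh.pow 2).continuousOn
  set X : Fin n → E n → ℝ := fun i y => h y ^ 2 * jac f y * gradLog f i y with hX
  have hXs : ∀ i, ContDiffOn ℝ ∞ (X i) U := contDiffOn_flux hf.toIsImmersionOn hh
  have hX0 : ∀ i, ∀ x ∈ U, x ∉ K → X i x = 0 := fun i x hx hxK => by
    simp [hX, h0 x hx hxK]
  -- The set `U \ K` is open, so vanishing there passes to derivatives.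
  have hpX0 : ∀ i, ∀ x ∈ U, x ∉ K → pd i (X i) x = 0 := fun i x hx hxK => by
    have h1 : EqOn (X i) (fun _ => 0) (U \ K) := fun y hy => hX0 i y hy.1 hy.2
    rw [pd_congr (hf.isOpen.sdiff hK.isClosed) ⟨hx, hxK⟩ h1, pd_const]
  have hXint : ∀ i, IntegrableOn (pd i (X i)) U (Measure.hausdorffMeasure (n : ℝ)) := fun i =>
    integrableOn_of_continuousOn_of_eq_zero hf.isOpen hK hKU
      (contDiffOn_pd (hXs i) hf.isOpen i).continuousOn (hpX0 i) _
  have hint1 : IntegrableOn (fun x => jac f x * (sqA f x * h x ^ 2)) U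
      (Measure.hausdorffMeasure (n : ℝ)) :=
    integrableOn_of_continuousOn_of_eq_zero hf.isOpen hK hKU
      (hJ.mul (hf.contDiffOn_sqA.continuousOn.mul hh2))
      (fun x hx hxK => by simp [h0 x hx hxK]) _
  have hint2 : IntegrableOn
      (fun x => jac f x * (sqGrad f h x + max (traceGradH f x) 0 * h x ^ 2)) U
      (Measure.hausdorffMeasure (n : ℝ)) :=
    integrableOn_of_continuousOn_of_eq_zero hf.isOpen hK hKU
      (hJ.mul ((hf.contDiffOn_sqGrad hh).continuousOn.add
        ((IsImmersionOn.contDiffOn_traceGradH hf.toIsImmersionOn).continuousOn.sup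
          continuousOn_const |>.mul hh2)))
      (fun x hx hxK => by simp [h0 x hx hxK, h0' x hx hxK]) _
  have hdiv : ∫ x in U, ∑ i, pd i (X i) x ∂Measure.hausdorffMeasure (n : ℝ) = 0 := by
    rw [integral_finsetSum _ fun i _ => hXint i]
    exact Finset.sum_eq_zero fun i _ => setIntegral_fderiv_eq_zero hf.isOpen hK hKU
      ((hXs i).of_le (by simp)) (hX0 i) _ _
  calc _ ≤ ∫ x in U, (jac f x * (sqGrad f h x + max (traceGradH f x) 0 * h x ^ 2)
          - ∑ i, pd i (X i) x) ∂Measure.hausdorffMeasure (n : ℝ) :=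
        setIntegral_mono_on hint1 (hint2.sub (integrable_finsetSum _ fun i _ => hXint i))
          hf.isOpen.measurableSet fun x hx => hf.jac_mul_sqA_le hx hflat hh
    _ = _ := by
        rw [integral_sub hint2 (integrable_finsetSum _ fun i _ => hXint i), hdiv, sub_zero]

end Integration

end FlatGraph

/-! ### The stability inequality on the graph. -/

theorem mainTheorem5 {n k : ℕ} (U : Set (FlatGraph.E n)) (hU : IsOpen U)
    (ψ : FlatGraph.E n → FlatGraph.E k) (hψ : ContDiffOn ℝ ∞ ψ U)
    (hflat : FlatGraph.FlatNormalBundle (FlatGraph.graphMap ψ) U)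
    (e : FlatGraph.E n → Fin n → FlatGraph.E n)
    (he : FlatGraph.IsTangentFrame (FlatGraph.graphMap ψ) U e)
    (ν : FlatGraph.E n → Fin k → FlatGraph.E (n + k))
    (hν : FlatGraph.IsNormalFrame (FlatGraph.graphMap ψ) U ν)
    (φ : FlatGraph.E (n + k) → ℝ) (hφ : FlatGraph.IsTestFunction U ψ φ) :
    IntegrableOn
        (fun p => FlatGraph.normSqA (FlatGraph.graphMap ψ) e (FlatGraph.base p) * φ p ^ 2)
        (FlatGraph.graph U ψ) (Measure.hausdorffMeasure (n : ℝ)) ∧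
      IntegrableOn
        (fun p => FlatGraph.normSqGrad (FlatGraph.graphMap ψ) e φ (FlatGraph.base p)
          + FlatGraph.K₁ (FlatGraph.graphMap ψ) e ν (FlatGraph.base p) * φ p ^ 2)
        (FlatGraph.graph U ψ) (Measure.hausdorffMeasure (n : ℝ)) ∧
      ∫ p in FlatGraph.graph U ψ,
          FlatGraph.normSqA (FlatGraph.graphMap ψ) e (FlatGraph.base p) * φ p ^ 2
          ∂(Measure.hausdorffMeasure (n : ℝ))
        ≤ ∫ p in FlatGraph.graph U ψ,
          (FlatGraph.normSqGrad (FlatGraph.graphMap ψ) e φ (FlatGraph.base p)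
            + FlatGraph.K₁ (FlatGraph.graphMap ψ) e ν (FlatGraph.base p) * φ p ^ 2)
          ∂(Measure.hausdorffMeasure (n : ℝ)) := by
  have hf := FlatGraph.isGraphOn_graphMap hU hψ
  obtain ⟨C, hCsub, hC, hC0⟩ := hφ.compact_support
  set f := FlatGraph.graphMap ψ
  set h : FlatGraph.E n → ℝ := fun x => φ (f x) with hh
  have hhs : ContDiffOn ℝ ∞ h U := hφ.smooth
  set K : Set (FlatGraph.E n) := FlatGraph.base '' C with hKdef
  have hK : IsCompact K := hC.image FlatGraph.continuous_base
  have hKU : K ⊆ U := by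
    rintro _ ⟨p, hp, rfl⟩
    obtain ⟨x, hx, rfl⟩ := hCsub hp
    rwa [hf.base_apply]
  have h0 : ∀ x ∈ U, x ∉ K → h x = 0 := fun x hx hxK =>
    hC0 _ (mem_image_of_mem _ hx) fun hmem => hxK ⟨_, hmem, hf.base_apply x⟩
  have h0' : ∀ x ∈ U, x ∉ K → FlatGraph.sqGrad f h x = 0 := fun x hx hxK => by
    have h1 : EqOn h (fun _ => 0) (U \ K) := fun y hy => h0 y hy.1 hy.2
    have h2 : ∀ i, FlatGraph.pd i h x = 0 := fun i => by
      rw [FlatGraph.pd_congr (hU.sdiff hK.isClosed) ⟨hx, hxK⟩ h1, FlatGraph.pd_const]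
    simp [FlatGraph.sqGrad, h2]
  have hA := hf.integrableOn_and_integral_eq hK hKU
    (g := fun x => FlatGraph.sqA f x * h x ^ 2)
    (G := fun p => FlatGraph.normSqA f e (FlatGraph.base p) * φ p ^ 2)
    (hf.contDiffOn_sqA.continuousOn.mul (hhs.pow 2).continuousOn)
    (fun x hx hxK => by simp [h0 x hx hxK])
    (fun x hx => by simp only [hf.base_apply, hf.normSqA_eq hx he, hh])
  have hB := hf.integrableOn_and_integral_eq hK hKU
    (g := fun x => FlatGraph.sqGrad f h x + max (FlatGraph.traceGradH f x) 0 * h x ^ 2)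
    (G := fun p => FlatGraph.normSqGrad f e φ (FlatGraph.base p)
      + FlatGraph.K₁ f e ν (FlatGraph.base p) * φ p ^ 2)
    ((hf.contDiffOn_sqGrad hhs).continuousOn.add
      ((FlatGraph.IsImmersionOn.contDiffOn_traceGradH hf.toIsImmersionOn).continuousOn.sup
        continuousOn_const |>.mul (hhs.pow 2).continuousOn))
    (fun x hx hxK => by simp [h0 x hx hxK, h0' x hx hxK])
    (fun x hx => by
      simp only [hf.base_apply, FlatGraph.normSqGrad_eq (he x hx), FlatGraph.K₁,
        hf.inv_w_mul_sum_eq hx he hν, hh])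
  refine ⟨hA.1, hB.1, ?_⟩
  change ∫ p in f '' U, _ ∂_ ≤ ∫ p in f '' U, _ ∂_
  rw [hA.2, hB.2]
  exact hf.setIntegral_jac_mul_sqA_le hflat hhs hK hKU h0 h0'
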